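/- **Theorem 5 (Ergodic capacity).** Let $I_1,I_2$ be independent random variables with the mixture Exponential-Generalized Gamma densities $$f_{I_i}(x)=\frac{\omega_i}{\lambda_i}e^{-x/\lambda_i}+(1-\omega_i)\frac{c_i\,x^{a_ic_i-1}}{b_i^{a_ic_i}\Gamma(a_i)}e^{-(x/b_i)^{c_i}},\qquad x>0,\ i=1,2,$$ where $0<\omega_i<1$ and $\lambda_i,a_i,b_i,c_i>0$. Let $r_1,r_2\in\{1,2\}$ ($1$ for heterodyne detection, $2$ for IM/DD), let $\eta,N_{0_1},N_{0_2}>0$, let $\gamma_i=(\eta I_i)^{r_i}/N_{0_i}$ be the SNR of hop $i$, and let $$\mu_i=\frac{\mathbb E[\gamma_i]}{\omega_i\lambda_i^{r_i}\Gamma(1+r_i)+(1-\omega_i)\,b_i^{r_i}\,\Gamma(a_i+r_i/c_i)/\Gamma(a_i)}$$ be its average electrical SNR (if the fading is normalized, $\mathbb E[I_i]=1$, this is $\mathbb E[\gamma_i]$ when $r_i=1$; the divisor is $2\omega_i\lambda_i^2+(1-\omega_i)b_i^2\Gamma(a_i+2/c_i)/\Gamma(a_i)$ when $r_i=2$). Let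 $C>0$, let $\gamma=\gamma_1\gamma_2/(\gamma_2+C)$ be the end-to-end SNR of the amplify-and-forward fixed-gain link, and let $\tau>0$ ($\tau=1$ for heterodyne detection, $\tau=e/(2\pi)$ for IM/DD). Then $\ln(1+\tau\gamma)$ is integrable, the four Fox $\mathrm H$ functions below are well defined, and the ergodic capacity is $$\begin{aligned}\mathbb E[\ln(1+\tau\gamma)]={}&\omega_1\omega_2\,\mathrm H\!\left[(1;1,1)\,\middle|\,\begin{matrix}(0,r_1)(1,1)\\(1,1)(0,1)\end{matrix}\,\middle|\,\begin{matrix}-\\(0,1)(1,r_2)\end{matrix}\,\middle|\,\tau\lambda_1^{r_1}\mu_1,\frac{C}{\lambda_2^{r_2}\mu_2}\right]\\ &+\frac{\omega_1(1-\omega_2)}{\Gamma(a_2)}\,\mathrm H\!\left[(1;1,1)\,\middle|\,\begin{matrix}(0,r_1)(1,1)\\(1,1)(0,1)\end{matrix}\,\middle|\,\begin{matrix}-\\(0,1)(a_2,\frac{r_2}{c_2})\end{matrix}\,\middle|\,\tau\lambda_1^{r_1}\mu_1,\frac{C}{b_2^{r_2}\mu_2}\right]\\ &+\frac{\omega_2(1-\omega_1)}{\Gamma(a_1)}\,\mathrm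 H\!\left[(1;1,1)\,\middle|\,\begin{matrix}(1,1)(1-a_1,\frac{r_1}{c_1})\\(1,1)(0,1)\end{matrix}\,\middle|\,\begin{matrix}-\\(0,1)(1,r_2)\end{matrix}\,\middle|\,\tau b_1^{r_1}\mu_1,\frac{C}{\lambda_2^{r_2}\mu_2}\right]\\ &+\frac{(1-\omega_1)(1-\omega_2)}{\Gamma(a_1)\Gamma(a_2)}\,\mathrm H\!\left[(1;1,1)\,\middle|\,\begin{matrix}(1,1)(1-a_1,\frac{r_1}{c_1})\\(1,1)(0,1)\end{matrix}\,\middle|\,\begin{matrix}-\\(0,1)(a_2,\frac{r_2}{c_2})\end{matrix}\,\middle|\,\tau b_1^{r_1}\mu_1,\frac{C}{b_2^{r_2}\mu_2}\right].\end{aligned}$$ Here $\mathrm H=\mathrm H^{0,1:1,2:2,0}_{1,0:2,2:0,2}$ is the bivariate Fox $\mathrm H$ function: for parameters $\left[(1;1,1)\,\middle|\,\begin{matrix}(e_1,E_1)(e_2,E_2)\\(1,1)(0,1)\end{matrix}\,\middle|\,\begin{matrix}-\\(d_1,D_1)(d_2,D_2)\end{matrix}\,\middle|\,x,y\right]$ it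 is $$\frac1{(2\pi i)^2}\int_{\mathcal C_1}\int_{\mathcal C_2}\Gamma(s+t)\,\frac{\Gamma(1-s)\,\Gamma(1-e_1+E_1s)\,\Gamma(1-e_2+E_2s)}{\Gamma(1+s)}\,\Gamma(d_1-D_1t)\,\Gamma(d_2-D_2t)\,x^s\,y^t\,dt\,ds,$$ where $\mathcal C_1,\mathcal C_2$ are vertical lines, directed upwards, in the $s$- and $t$-plane which separate the poles of the factors in the numerator, that is, on which $\Gamma(s+t)$, $\Gamma(1-s)$, $\Gamma(1-e_j+E_js)$ and $\Gamma(d_j-D_jt)$ all have arguments with positive real part. Well defined means that such lines exist, and that along all of them the double integral converges absolutely to the same value. -/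

import Mathlib

open MeasureTheory ProbabilityTheory

noncomputable section

/-! ### The Fox H function of two variables -/

/-- Parameters of the joint gamma factor of `H^{0,n:...}_{p,q:...}`: the upper triples
`(α_j; a_j, A_j)`, `j = 1, …, p`, the lower triples `(β_j; b_j, B_j)`, `j = 1, …, q`, and the
number `n` of upper triples whose gamma factor is in the numerator. -/
structure FoxHJointBlock (n p q : ℕ) where
  upper : Fin p → ℝ × ℝ × ℝ
  lower : Fin q → ℝ × ℝ × ℝ

/-- Parameters of a one-variable gamma factor with orders `m, n` and `p, q`: the upper pairs
`(c_j, γ_j)`, `j = 1, …, p`, of which the first `n` are in the numerator, and the lower pairs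
`(d_j, δ_j)`, `j = 1, …, q`, of which the first `m` are in the numerator. -/
structure FoxHBlock (m n p q : ℕ) where
  upper : Fin p → ℝ × ℝ
  lower : Fin q → ℝ × ℝ

/-- `∏_{j ≤ n} Γ(1 - α_j + a_j s + A_j t)` divided by
`∏_{n < j ≤ p} Γ(α_j - a_j s - A_j t) ∏_{j ≤ q} Γ(1 - β_j + b_j s + B_j t)`. -/
def FoxHJointBlock.kernel {n p q : ℕ} (J : FoxHJointBlock n p q) (s t : ℂ) : ℂ :=
  (∏ j : Fin p,
    if j.val < n then
      Complex.Gamma (1 - (J.upper j).1 + (J.upper j).2.1 * s + (J.upper j).2.2 * t)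
    else
      (Complex.Gamma ((J.upper j).1 - (J.upper j).2.1 * s - (J.upper j).2.2 * t))⁻¹) *
  ∏ j : Fin q,
    (Complex.Gamma (1 - (J.lower j).1 + (J.lower j).2.1 * s + (J.lower j).2.2 * t))⁻¹

/-- `∏_{j ≤ m} Γ(d_j - δ_j s) ∏_{j ≤ n} Γ(1 - c_j + γ_j s)` divided by
`∏_{m < j ≤ q} Γ(1 - d_j + δ_j s) ∏_{n < j ≤ p} Γ(c_j - γ_j s)`. -/
def FoxHBlock.kernel {m n p q : ℕ} (A : FoxHBlock m n p q) (s : ℂ) : ℂ :=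
  (∏ j : Fin q,
    if j.val < m then Complex.Gamma ((A.lower j).1 - (A.lower j).2 * s)
    else (Complex.Gamma (1 - (A.lower j).1 + (A.lower j).2 * s))⁻¹) *
  ∏ j : Fin p,
    if j.val < n then Complex.Gamma (1 - (A.upper j).1 + (A.upper j).2 * s)
    else (Complex.Gamma ((A.upper j).1 - (A.upper j).2 * s))⁻¹

/-- The line `Re s = σ` separates the poles of the numerator gamma factors: those of
`Γ(d_j - δ_j s)` lie to its right, those of `Γ(1 - c_j + γ_j s)` to its left
(the coefficients `δ_j`, `γ_j` of a Fox H function are positive). -/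
def FoxHBlock.Separates {m n p q : ℕ} (A : FoxHBlock m n p q) (σ : ℝ) : Prop :=
  (∀ j : Fin q, j.val < m → 0 < (A.lower j).1 - (A.lower j).2 * σ) ∧
  (∀ j : Fin p, j.val < n → 0 < 1 - (A.upper j).1 + (A.upper j).2 * σ)

/-- On the lines `Re s = σ`, `Re t = κ`, the poles of `Γ(1 - α_j + a_j s + A_j t)`, as a function of
either variable, lie to the left of the contour of that variable. -/
def FoxHJointBlock.Separates {n p q : ℕ} (J : FoxHJointBlock n p q) (σ κ : ℝ) : Prop :=
  ∀ j : Fin p, j.val < n →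
    0 < 1 - (J.upper j).1 + (J.upper j).2.1 * σ + (J.upper j).2.2 * κ

section Bivariate

variable {n₁ p₁ q₁ m₂ n₂ p₂ q₂ m₃ n₃ p₃ q₃ : ℕ}

/-- The integrand `φ(s, t) θ₂(s) θ₃(t) x ^ s y ^ t` at `s = σ + i u`, `t = κ + i v`. -/
def foxHIntegrand (J : FoxHJointBlock n₁ p₁ q₁) (A : FoxHBlock m₂ n₂ p₂ q₂)
    (B : FoxHBlock m₃ n₃ p₃ q₃) (x y σ κ : ℝ) (z : ℝ × ℝ) : ℂ :=
  let s : ℂ := σ + z.1 * Complex.I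
  let t : ℂ := κ + z.2 * Complex.I
  J.kernel s t * A.kernel s * B.kernel t * (x : ℂ) ^ s * (y : ℂ) ^ t

/-- `h` is the value at `(x, y)` of the bivariate Fox H function, i.e. of the Mellin–Barnes integral
`(2πi)⁻² ∫_{C₁} ∫_{C₂} φ(s, t) θ₂(s) θ₃(t) x ^ s y ^ t dt ds` over contours running from `-i∞` to
`+i∞` and separating the poles. The contours are vertical lines `Re s = σ`, `Re t = κ`, so that
`ds dt = i² du dv`; at least one separating pair of lines exists, and along every such pair the
double integral converges absolutely to `h`. -/
def IsBivariateFoxH (J : FoxHJointBlock n₁ p₁ q₁) (A : FoxHBlock m₂ n₂ p₂ q₂)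
    (B : FoxHBlock m₃ n₃ p₃ q₃) (x y : ℝ) (h : ℂ) : Prop :=
  (∃ σ κ : ℝ, J.Separates σ κ ∧ A.Separates σ ∧ B.Separates κ) ∧
  ∀ σ κ : ℝ, J.Separates σ κ → A.Separates σ → B.Separates κ →
    Integrable (foxHIntegrand J A B x y σ κ) (volume : Measure (ℝ × ℝ)) ∧
    (1 / (2 * Real.pi * Complex.I)) ^ 2 *
      (Complex.I ^ 2 * ∫ z : ℝ × ℝ, foxHIntegrand J A B x y σ κ z) = h

/-- The defining Mellin–Barnes integral exists. -/
def BivariateFoxHConverges (J : FoxHJointBlock n₁ p₁ q₁) (A : FoxHBlock m₂ n₂ p₂ q₂)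
    (B : FoxHBlock m₃ n₃ p₃ q₃) (x y : ℝ) : Prop :=
  ∃ h : ℂ, IsBivariateFoxH J A B x y h

open Classical in
/-- The bivariate Fox H function `H^{0,n₁:m₂,n₂:m₃,n₃}_{p₁,q₁:p₂,q₂:p₃,q₃}[J | A | B | x, y]`
(and `0` where the defining integral does not exist). -/
def bivariateFoxH (J : FoxHJointBlock n₁ p₁ q₁) (A : FoxHBlock m₂ n₂ p₂ q₂)
    (B : FoxHBlock m₃ n₃ p₃ q₃) (x y : ℝ) : ℂ :=
  if h : BivariateFoxHConverges J A B x y then h.choose else 0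

end Bivariate

/-! ### The parameter lists of the capacity formula -/

/-- `(1; 1, 1) | --` -/
def capacityJoint : FoxHJointBlock 1 1 0 := ⟨![(1, 1, 1)], ![]⟩

/-- `(0, r), (1, 1) | (1, 1), (0, 1)` -/
def capacityFirstExp (r : ℕ) : FoxHBlock 1 2 2 2 :=
  ⟨![(0, (r : ℝ)), (1, 1)], ![(1, 1), (0, 1)]⟩

/-- `(1, 1), (1 - a, r / c) | (1, 1), (0, 1)` -/
def capacityFirstGG (a c : ℝ) (r : ℕ) : FoxHBlock 1 2 2 2 :=
  ⟨![(1, 1), (1 - a, r / c)], ![(1, 1), (0, 1)]⟩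

/-- `-- | (0, 1), (1, r)` -/
def capacitySecondExp (r : ℕ) : FoxHBlock 2 0 0 2 :=
  ⟨![], ![(0, 1), (1, (r : ℝ))]⟩

/-- `-- | (0, 1), (a, r / c)` -/
def capacitySecondGG (a c : ℝ) (r : ℕ) : FoxHBlock 2 0 0 2 :=
  ⟨![], ![(0, 1), (a, r / c)]⟩

/-! ### The mixture Exponential-Generalized Gamma channel -/

/-- The density of the mixture Exponential-Generalized Gamma (EGG) distribution. -/
def eggPDF (ω lam a b c x : ℝ) : ℝ :=
  if 0 < x then
    ω / lam * Real.exp (-(x / lam)) +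
      (1 - ω) * (c * x ^ (a * c - 1) / (b ^ (a * c) * Real.Gamma a)) *
        Real.exp (-((x / b) ^ c))
  else 0

/-- The mixture EGG distribution. -/
def eggMeasure (ω lam a b c : ℝ) : Measure ℝ :=
  volume.withDensity fun x => ENNReal.ofReal (eggPDF ω lam a b c x)

/-- The instantaneous SNR `(η I) ^ r / N₀` of a hop with irradiance `I`. -/
def hopSNR (η N₀ : ℝ) (r : ℕ) (I : ℝ) : ℝ := (η * I) ^ r / N₀

/-- The average electrical SNR of a hop whose average SNR is `γbar`: the quotient of `γbar` by the
`r`-th moment `ω λ ^ r Γ(1 + r) + (1 - ω) b ^ r Γ(a + r / c) / Γ(a)` of the irradiance. For `r = 2`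
the divisor is `2 ω λ ^ 2 + b ^ 2 (1 - ω) Γ(a + 2 / c) / Γ(a)`; for `r = 1` it is the mean
irradiance, which is `1` (so that the value is `γbar`) when the fading is normalized. -/
def averageElectricalSNR (ω lam a b c : ℝ) (r : ℕ) (γbar : ℝ) : ℝ :=
  γbar / (ω * lam ^ r * Real.Gamma (1 + r) +
    (1 - ω) * b ^ r * (Real.Gamma (a + r / c) / Real.Gamma a))

/-- The end-to-end SNR of the dual-hop link with a fixed-gain relay. -/
def endToEndSNR (C γ₁ γ₂ : ℝ) : ℝ := γ₁ * γ₂ / (γ₂ + C)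

end

/-!
For `p, q ≥ 0`, `log (1 + p / (1 + q)) = ∫₀¹ ∫₀^∞ p e ^ (-p x y) e ^ (-q y) e ^ (-y) dy dx`. With
`A = p x y` and `B = q y`, Mellin inversion writes `A e ^ (-A)` and `e ^ (-B)` as integrals of
`Γ(1 - s) A ^ s` and `Γ(-t) B ^ t` over vertical lines. After an application of Fubini's theorem,
the `x`- and `y`-integrals produce `1 / s` and `Γ(s + t)`. Averaging over `p = τ μ₁ I₁ ^ r₁` and
`q = C / (μ₂ I₂ ^ r₂)`, for which `τ γ = p / (1 + q)`, contributes fractional moments of `I₁` and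
`I₂`, which for generalized gamma laws are quotients of gamma functions. The double integral is then
a bivariate Fox H function; that it does not depend on the lines is automatic, as its value is the
capacity for every choice. The EGG law is a mixture of two generalized gamma laws, the exponential
one being the case `a = c = 1`, whence the four terms.
-/

noncomputable section

open Complex Set

/-! ### Mellin–Barnes integrals -/

lemma norm_Gamma_le_Gamma_re {z : ℂ} (hz : 0 < z.re) : ‖Gamma z‖ ≤ Real.Gamma z.re := by
  rw [Gamma_eq_integral hz, Real.Gamma_eq_integral hz, GammaIntegral]
  refine (norm_integral_le_integral_norm _).trans_eq
    (setIntegral_congr_fun measurableSet_Ioi fun x hx => ?_)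
  simp only [norm_mul, norm_real, Real.norm_eq_abs, Real.abs_exp, sub_re, one_re,
    norm_cpow_eq_rpow_re_of_pos hx]

lemma norm_Gamma_le_inv_one_add_sq {z : ℂ} (hz : 0 < z.re) :
    ‖Gamma z‖ ≤ (Real.Gamma z.re + Real.Gamma (z.re + 2)) * (1 + z.im ^ 2)⁻¹ := by
  have hz1 : 0 < (z + 1).re := by simpa using add_pos hz one_pos
  have hshift : Gamma (z + 2) = (z + 1) * (z * Gamma z) := by
    rw [← Gamma_add_one z (ne_zero_of_re_pos hz), ← Gamma_add_one _ (ne_zero_of_re_pos hz1)]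
    ring_nf
  have hsq : z.im ^ 2 ≤ ‖z + 1‖ * ‖z‖ := by
    rw [← sq_abs, sq]
    exact mul_le_mul (by simpa using abs_im_le_norm (z + 1)) (abs_im_le_norm z) (abs_nonneg _)
      (norm_nonneg _)
  rw [← div_eq_mul_inv, le_div_iff₀ (by positivity)]
  calc ‖Gamma z‖ * (1 + z.im ^ 2)
      ≤ ‖Gamma z‖ * (1 + ‖z + 1‖ * ‖z‖) := by gcongr
    _ = ‖Gamma z‖ + ‖Gamma (z + 2)‖ := by rw [hshift, norm_mul, norm_mul]; ring
    _ ≤ Real.Gamma z.re + Real.Gamma (z.re + 2) :=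
        add_le_add (norm_Gamma_le_Gamma_re hz)
          (by simpa using norm_Gamma_le_Gamma_re (z := z + 2) (by simpa using by linarith))

lemma continuous_Gamma_sub_vertical {a σ : ℝ} (hσ : σ < a) :
    Continuous fun u : ℝ => Gamma (a - (σ + u * I)) := by
  refine continuous_iff_continuousAt.2 fun u => ?_
  refine (differentiableAt_Gamma _ fun m hm => ?_).continuousAt.comp (by fun_prop)
  have hre : a - σ = -(m : ℝ) := by simpa using congrArg re hm
  linarith [Nat.cast_nonneg (α := ℝ) m]

lemma integrable_Gamma_sub_vertical {a σ : ℝ} (hσ : σ < a) :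
    Integrable fun u : ℝ => Gamma (a - (σ + u * I)) := by
  refine (integrable_inv_one_add_sq.const_mul
    (Real.Gamma (a - σ) + Real.Gamma (a - σ + 2))).mono'
    (continuous_Gamma_sub_vertical hσ).aestronglyMeasurable (.of_forall fun u => ?_)
  simpa using norm_Gamma_le_inv_one_add_sq (z := a - (σ + u * I)) (by simpa using hσ)

/- Inversion of the Mellin transform `∫₀^∞ x ^ (s - 1) e ^ (-x) dx = Γ(s)` along `Re s = a - σ`. -/
lemma integral_Gamma_sub_mul_cpow_vertical {a σ A : ℝ} (hσ : σ < a) (hA : 0 < A) :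
    ∫ u : ℝ, Gamma (a - (σ + u * I)) * (A : ℂ) ^ (σ + u * I) =
      2 * Real.pi * ((A : ℂ) ^ (a : ℂ) * Real.exp (-A)) := by
  set f : ℝ → ℂ := fun x => (Real.exp (-x) : ℝ) with hf
  have hmellin (u : ℝ) : mellin f ((a - σ : ℝ) + u * I) = Gamma (a - (σ + (-u : ℝ) * I)) := by
    rw [hf, ← GammaIntegral_eq_mellin, ← Gamma_eq_integral (by simpa using hσ)]
    congr 1
    push_cast
    ring
  have hconv : MellinConvergent f (a - σ : ℝ) := by
    refine (GammaIntegral_convergent (s := (a - σ : ℝ)) (by simpa using hσ)).congr_fun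
      (fun x _ => ?_) measurableSet_Ioi
    rw [smul_eq_mul, mul_comm]
  have hinv := mellinInv_mellin_eq (a - σ) f hA hconv
    ((integrable_Gamma_sub_vertical hσ).comp_neg.congr (.of_forall fun u => (hmellin u).symm))
    (by fun_prop)
  calc ∫ u : ℝ, Gamma (a - (σ + u * I)) * (A : ℂ) ^ (σ + u * I)
      = ∫ u : ℝ, Gamma (a - (σ + (-u : ℝ) * I)) * (A : ℂ) ^ (σ + (-u : ℝ) * I) :=
        (integral_neg_eq_self _ _).symm
    _ = ∫ u : ℝ, (A : ℂ) ^ (a : ℂ) *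
          ((A : ℂ) ^ (-((a - σ : ℝ) + u * I)) • mellin f ((a - σ : ℝ) + u * I)) := by
        refine integral_congr_ae (.of_forall fun u => ?_)
        beta_reduce
        rw [hmellin, smul_eq_mul, ← mul_assoc, ← cpow_add _ _ (ofReal_ne_zero.2 hA.ne'), mul_comm]
        congr 2
        push_cast
        ring
    _ = 2 * Real.pi * ((A : ℂ) ^ (a : ℂ) * f A) := by
        have hpi : (2 * Real.pi : ℂ) * (1 / (2 * Real.pi) : ℝ) = 1 := by
          exact_mod_cast mul_one_div_cancel Real.two_pi_pos.ne'
        rw [integral_const_mul, ← hinv, mellinInv, real_smul, mul_left_comm (2 * Real.pi : ℂ),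
          ← mul_assoc (2 * Real.pi : ℂ), hpi, one_mul]

lemma integral_Gamma_mul_cpow_vertical_prod {A B σ κ : ℝ} (hA : 0 < A) (hB : 0 < B) (hσ : σ < 1)
    (hκ : κ < 0) (g : ℂ) :
    ∫ p : ℝ × ℝ, Gamma (1 - (σ + p.1 * I)) * Gamma (-(κ + p.2 * I)) *
      ((A : ℂ) ^ (σ + p.1 * I) * (B : ℂ) ^ (κ + p.2 * I) * g) =
    (2 * Real.pi) ^ 2 * (A * Real.exp (-A) * Real.exp (-B) * g) := by
  have hs := integral_Gamma_sub_mul_cpow_vertical hσ hA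
  have ht := integral_Gamma_sub_mul_cpow_vertical hκ hB
  simp only [ofReal_one, ofReal_zero, zero_sub, cpow_one, cpow_zero, one_mul] at hs ht
  calc ∫ p : ℝ × ℝ, Gamma (1 - (σ + p.1 * I)) * Gamma (-(κ + p.2 * I)) *
        ((A : ℂ) ^ (σ + p.1 * I) * (B : ℂ) ^ (κ + p.2 * I) * g)
      = ∫ p : ℝ × ℝ, (Gamma (1 - (σ + p.1 * I)) * (A : ℂ) ^ (σ + p.1 * I)) *
          (Gamma (-(κ + p.2 * I)) * (B : ℂ) ^ (κ + p.2 * I)) * g :=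
        integral_congr_ae (.of_forall fun p => by ring)
    _ = (2 * Real.pi * (A * Real.exp (-A))) * (2 * Real.pi * Real.exp (-B)) * g := by
        rw [integral_mul_const, Measure.volume_eq_prod,
          integral_prod_mul (fun u : ℝ => Gamma (1 - (σ + u * I)) * (A : ℂ) ^ (σ + u * I))
            (fun v : ℝ => Gamma (-(κ + v * I)) * (B : ℂ) ^ (κ + v * I)), hs, ht]
    _ = (2 * Real.pi) ^ 2 * (A * Real.exp (-A) * Real.exp (-B) * g) := by ring

/-! ### Joint moments of complex order -/

/-- The joint moment `∫ A ^ s B ^ t g dν` of complex orders `s`, `t`, with weight `g`. -/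
def jointMoment {Z : Type*} [MeasurableSpace Z] (ν : Measure Z) (A B : Z → ℝ) (g : Z → ℂ)
    (s t : ℂ) : ℂ :=
  ∫ z, (A z : ℂ) ^ s * (B z : ℂ) ^ t * g z ∂ν

/-- The positive functions `A` and `B` have an absolutely convergent joint moment with weight `g` of
all orders `s`, `t` on the lines `Re s = σ`, `Re t = κ`. -/
structure HasJointMoment {Z : Type*} [MeasurableSpace Z] (ν : Measure Z) (A B : Z → ℝ) (g : Z → ℂ)
    (σ κ : ℝ) : Prop where
  aemeasurable_left : AEMeasurable A ν
  aemeasurable_right : AEMeasurable B ν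
  aestronglyMeasurable_weight : AEStronglyMeasurable g ν
  pos_left : ∀ᵐ z ∂ν, 0 < A z
  pos_right : ∀ᵐ z ∂ν, 0 < B z
  integrable : Integrable (fun z => (A z : ℂ) ^ (σ : ℂ) * (B z : ℂ) ^ (κ : ℂ) * g z) ν

namespace HasJointMoment

variable {Z : Type*} [MeasurableSpace Z] {ν : Measure Z} {A B : Z → ℝ} {g : Z → ℂ} {σ κ : ℝ}

lemma integrable_Gamma_mul_cpow_vertical (h : HasJointMoment ν A B g σ κ) (hσ : σ < 1)
    (hκ : κ < 0) :
    Integrable (fun p : Z × ℝ × ℝ => Gamma (1 - (σ + p.2.1 * I)) * Gamma (-(κ + p.2.2 * I)) *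
      ((A p.1 : ℂ) ^ (σ + p.2.1 * I) * (B p.1 : ℂ) ^ (κ + p.2.2 * I) * g p.1))
      (ν.prod volume) := by
  have hs := integrable_Gamma_sub_vertical hσ
  have ht := integrable_Gamma_sub_vertical hκ
  simp only [ofReal_one, ofReal_zero, zero_sub] at hs ht
  have hk := hs.mul_prod ht
  refine (h.integrable.norm.mul_prod hk.norm).mono' ?_ ?_
  · have hA : AEMeasurable (fun p : Z × ℝ × ℝ => (A p.1 : ℂ)) (ν.prod volume) :=
      measurable_ofReal.comp_aemeasurable h.aemeasurable_left.comp_fst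
    have hB : AEMeasurable (fun p : Z × ℝ × ℝ => (B p.1 : ℂ)) (ν.prod volume) :=
      measurable_ofReal.comp_aemeasurable h.aemeasurable_right.comp_fst
    exact hk.aestronglyMeasurable.comp_snd.mul
      (((hA.pow (by fun_prop)).mul (hB.pow (by fun_prop))).aestronglyMeasurable.mul
        h.aestronglyMeasurable_weight.comp_fst)
  · filter_upwards [Measure.quasiMeasurePreserving_fst.ae h.pos_left,
      Measure.quasiMeasurePreserving_fst.ae h.pos_right] with p hA hB
    simp only [norm_mul, norm_cpow_eq_rpow_re_of_pos hA, norm_cpow_eq_rpow_re_of_pos hB]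
    simp [mul_comm]

lemma integrable_mul_exp_neg_mul_exp_neg (h : HasJointMoment ν A B g σ κ) (hσ : σ < 1)
    (hκ : κ < 0) :
    Integrable (fun z => A z * Real.exp (-A z) * Real.exp (-B z) * g z) ν := by
  have hpi : ((2 * Real.pi : ℂ) ^ 2) ≠ 0 := pow_ne_zero 2 (by exact_mod_cast Real.two_pi_pos.ne')
  rw [← integrable_const_mul_iff hpi.isUnit]
  refine (h.integrable_Gamma_mul_cpow_vertical hσ hκ).integral_prod_left.congr ?_
  filter_upwards [h.pos_left, h.pos_right] with z hA hB
  exact integral_Gamma_mul_cpow_vertical_prod hA hB hσ hκ (g z)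

variable [SFinite ν]

lemma integrable_Gamma_mul_jointMoment (h : HasJointMoment ν A B g σ κ) (hσ : σ < 1)
    (hκ : κ < 0) :
    Integrable fun p : ℝ × ℝ => Gamma (1 - (σ + p.1 * I)) * Gamma (-(κ + p.2 * I)) *
      jointMoment ν A B g (σ + p.1 * I) (κ + p.2 * I) := by
  simpa only [jointMoment, integral_const_mul] using
    (h.integrable_Gamma_mul_cpow_vertical hσ hκ).integral_prod_right

lemma integral_Gamma_mul_jointMoment (h : HasJointMoment ν A B g σ κ) (hσ : σ < 1) (hκ : κ < 0) :
    ∫ p : ℝ × ℝ, Gamma (1 - (σ + p.1 * I)) * Gamma (-(κ + p.2 * I)) *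
      jointMoment ν A B g (σ + p.1 * I) (κ + p.2 * I) =
    (2 * Real.pi) ^ 2 * ∫ z, A z * Real.exp (-A z) * Real.exp (-B z) * g z ∂ν := by
  simp only [jointMoment, ← integral_const_mul]
  rw [← integral_integral_swap (h.integrable_Gamma_mul_cpow_vertical hσ hκ)]
  refine integral_congr_ae ?_
  filter_upwards [h.pos_left, h.pos_right] with z hA hB
  exact integral_Gamma_mul_cpow_vertical_prod hA hB hσ hκ (g z)

end HasJointMoment

/-! ### The logarithm as a superposition of exponentials -/

/-- Lebesgue measure on the half-strip `(0, 1] × (0, ∞)`, over which the exponentials are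
superposed. -/
def halfStrip : Measure (ℝ × ℝ) := (volume.restrict (Ioc 0 1)).prod (volume.restrict (Ioi 0))

instance : SFinite halfStrip := inferInstanceAs (SFinite (Measure.prod _ _))

lemma ae_halfStrip_pos : ∀ᵐ z ∂halfStrip, 0 < z.1 ∧ 0 < z.2 := by
  filter_upwards [Measure.quasiMeasurePreserving_fst.ae (ae_restrict_mem measurableSet_Ioc),
    Measure.quasiMeasurePreserving_snd.ae (ae_restrict_mem measurableSet_Ioi)] with z hx hy
  exact ⟨hx.1, hy⟩

lemma integral_div_add_mul_Ioc {p d : ℝ} (hp : 0 ≤ p) (hd : 0 < d) :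
    ∫ x in Ioc (0 : ℝ) 1, p / (d + p * x) = Real.log (1 + p / d) := by
  have hpos {x : ℝ} (hx : x ∈ uIcc (0 : ℝ) 1) : d + p * x ≠ 0 := by
    rw [uIcc_of_le zero_le_one] at hx
    nlinarith [mul_nonneg hp hx.1]
  have hderiv : ∀ x ∈ uIcc (0 : ℝ) 1,
      HasDerivAt (fun x => Real.log (d + p * x)) (p / (d + p * x)) x := fun x hx => by
    simpa using (((hasDerivAt_id x).const_mul p).const_add d).log (hpos hx)
  have hcont : ContinuousOn (fun x => p / (d + p * x)) (uIcc 0 1) :=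
    continuousOn_const.div (by fun_prop) fun x hx => hpos hx
  rw [← intervalIntegral.integral_of_le zero_le_one,
    intervalIntegral.integral_eq_sub_of_hasDerivAt hderiv hcont.intervalIntegrable,
    ← Real.log_div (hpos (by simp)) (hpos (by simp)), mul_one, mul_zero, add_zero, add_div,
    div_self hd.ne']

lemma integrable_exp_halfStrip {p d : ℝ} (hp : 0 ≤ p) (hd : 0 < d) :
    Integrable (fun z => p * Real.exp (-(d + p * z.1) * z.2)) halfStrip := by
  have hbound : Integrable (fun z => p * Real.exp (-d * z.2)) halfStrip :=
    (integrable_const p).mul_prod (integrableOn_exp_mul_Ioi (neg_lt_zero.2 hd) 0)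
  refine hbound.mono' (by fun_prop) ?_
  filter_upwards [ae_halfStrip_pos] with z ⟨hx, hy⟩
  rw [Real.norm_of_nonneg (by positivity)]
  gcongr
  exact le_add_of_nonneg_right (by positivity)

lemma integral_exp_halfStrip {p d : ℝ} (hp : 0 ≤ p) (hd : 0 < d) :
    ∫ z, p * Real.exp (-(d + p * z.1) * z.2) ∂halfStrip = Real.log (1 + p / d) := by
  rw [← integral_div_add_mul_Ioc hp hd, halfStrip, integral_prod _ (integrable_exp_halfStrip hp hd)]
  refine setIntegral_congr_fun measurableSet_Ioc fun x hx => ?_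
  have hpos : 0 < d + p * x := add_pos_of_pos_of_nonneg hd (mul_nonneg hp hx.1.le)
  rw [integral_const_mul, integral_exp_mul_Ioi (neg_lt_zero.2 hpos), mul_zero,
    Real.exp_zero, neg_div_neg_eq, mul_one_div]

lemma integrableOn_cpow_sub_one_Ioc {s : ℂ} (hs : 0 < s.re) :
    IntegrableOn (fun x : ℝ => (x : ℂ) ^ (s - 1)) (Ioc 0 1) :=
  (intervalIntegrable_iff_integrableOn_Ioc_of_le zero_le_one).1
    (intervalIntegral.intervalIntegrable_cpow' (by simpa using hs))

lemma integral_cpow_sub_one_Ioc {s : ℂ} (hs : 0 < s.re) :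
    ∫ x : ℝ in Ioc 0 1, (x : ℂ) ^ (s - 1) = 1 / s := by
  rw [← intervalIntegral.integral_of_le zero_le_one, integral_cpow (.inl (by simpa using hs)),
    sub_add_cancel, ofReal_one, ofReal_zero, one_cpow, zero_cpow (ne_zero_of_re_pos hs), sub_zero]

lemma integrable_cpow_halfStrip {s s' : ℂ} (hs : 0 < s.re) (hs' : 0 < s'.re) :
    Integrable (fun z : ℝ × ℝ => (z.1 : ℂ) ^ (s - 1) * (Real.exp (-z.2) * (z.2 : ℂ) ^ (s' - 1)))
      halfStrip :=
  (integrableOn_cpow_sub_one_Ioc hs).mul_prod (GammaIntegral_convergent hs')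

lemma integral_cpow_halfStrip {s s' : ℂ} (hs : 0 < s.re) (hs' : 0 < s'.re) :
    ∫ z, (z.1 : ℂ) ^ (s - 1) * (Real.exp (-z.2) * (z.2 : ℂ) ^ (s' - 1)) ∂halfStrip =
      1 / s * Gamma s' := by
  rw [halfStrip, integral_prod_mul (fun x : ℝ => (x : ℂ) ^ (s - 1))
    (fun y : ℝ => Real.exp (-y) * (y : ℂ) ^ (s' - 1)), integral_cpow_sub_one_Ioc hs,
    Gamma_eq_integral hs', GammaIntegral]

lemma cpow_mul_cpow_mul_exp_div {p q x y : ℝ} (hp : 0 < p) (hq : 0 < q) (hx : 0 < x) (hy : 0 < y)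
    (s t : ℂ) :
    ((p * x * y : ℝ) : ℂ) ^ s * ((q * y : ℝ) : ℂ) ^ t * (Real.exp (-y) / (x * y) : ℝ) =
      ((p : ℂ) ^ s * (q : ℂ) ^ t) *
        ((x : ℂ) ^ (s - 1) * (Real.exp (-y) * (y : ℂ) ^ (s + t - 1))) := by
  have hx' : (x : ℂ) ≠ 0 := ofReal_ne_zero.2 hx.ne'
  have hy' : (y : ℂ) ≠ 0 := ofReal_ne_zero.2 hy.ne'
  rw [ofReal_mul, mul_cpow_ofReal_nonneg (by positivity) hy.le, ofReal_mul,
    mul_cpow_ofReal_nonneg hp.le hx.le, ofReal_mul, mul_cpow_ofReal_nonneg hq.le hy.le,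
    cpow_sub _ _ hx', cpow_sub _ _ hy', cpow_add _ _ hy', cpow_one, cpow_one, ofReal_div,
    ofReal_mul]
  field_simp

lemma integral_superposition_eq_log {p q : ℝ} (hp : 0 < p) (hq : 0 < q) :
    ∫ z : ℝ × ℝ, ((p * z.1 * z.2 : ℝ) : ℂ) * Real.exp (-(p * z.1 * z.2)) * Real.exp (-(q * z.2)) *
      (Real.exp (-z.2) / (z.1 * z.2) : ℝ) ∂halfStrip = Real.log (1 + p / (1 + q)) := by
  rw [← integral_exp_halfStrip hp.le (add_pos one_pos hq), ← integral_complex_ofReal]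
  refine integral_congr_ae ?_
  filter_upwards [ae_halfStrip_pos] with z ⟨hx, hy⟩
  norm_cast
  calc p * z.1 * z.2 * Real.exp (-(p * z.1 * z.2)) * Real.exp (-(q * z.2)) *
        (Real.exp (-z.2) / (z.1 * z.2))
      = p * (Real.exp (-(p * z.1 * z.2)) * Real.exp (-(q * z.2)) * Real.exp (-z.2)) := by
        field_simp
    _ = p * Real.exp (-(1 + q + p * z.1) * z.2) := by
        rw [← Real.exp_add, ← Real.exp_add]
        ring_nf

/-- The gamma factors of the Mellin–Barnes integrand of `∫ log (1 + p / (1 + q))` which do not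
depend on the law of `p` and `q`. The quotient `1 / s` stands for `Γ(s) / Γ(1 + s)`. -/
def capacityKernel (s t : ℂ) : ℂ := Gamma (1 - s) * Gamma (-t) * (1 / s * Gamma (s + t))

section Superposition

variable {W : Type*} [MeasurableSpace W] {ν : Measure W} {p q : W → ℝ} {σ κ : ℝ}

lemma ae_prod_halfStrip_pos (hp : ∀ᵐ w ∂ν, 0 < p w) (hq : ∀ᵐ w ∂ν, 0 < q w) :
    ∀ᵐ z ∂ν.prod halfStrip, 0 < p z.1 ∧ 0 < q z.1 ∧ 0 < z.2.1 ∧ 0 < z.2.2 := by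
  filter_upwards [Measure.quasiMeasurePreserving_fst.ae hp,
    Measure.quasiMeasurePreserving_fst.ae hq,
    Measure.quasiMeasurePreserving_snd.ae ae_halfStrip_pos] with z hp hq hxy
  exact ⟨hp, hq, hxy⟩

lemma HasJointMoment.prod_halfStrip (h : HasJointMoment ν p q 1 σ κ) (hσ : 0 < σ)
    (hσκ : 0 < σ + κ) :
    HasJointMoment (ν.prod halfStrip) (fun z => p z.1 * z.2.1 * z.2.2) (fun z => q z.1 * z.2.2)
      (fun z => (Real.exp (-z.2.2) / (z.2.1 * z.2.2) : ℝ)) σ κ := by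
  have hpos := ae_prod_halfStrip_pos h.pos_left h.pos_right
  refine ⟨(h.aemeasurable_left.comp_fst.mul (by fun_prop)).mul (by fun_prop),
    h.aemeasurable_right.comp_fst.mul (by fun_prop),
    (by fun_prop : Measurable _).aestronglyMeasurable, ?_, ?_, ?_⟩
  · filter_upwards [hpos] with z ⟨hp, _, hx, hy⟩ using by positivity
  · filter_upwards [hpos] with z ⟨_, hq, _, hy⟩ using by positivity
  · refine (h.integrable.mul_prod (integrable_cpow_halfStrip (s := σ) (s' := σ + κ)
      (by simpa using hσ) (by simpa using hσκ))).congr ?_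
    filter_upwards [hpos] with z ⟨hp, hq, hx, hy⟩
    rw [cpow_mul_cpow_mul_exp_div hp hq hx hy, Pi.one_apply, mul_one]

lemma HasJointMoment.integrable_log (h : HasJointMoment ν p q 1 σ κ) (hσ : 0 < σ) (hσ1 : σ < 1)
    (hκ : κ < 0) (hσκ : 0 < σ + κ) : Integrable (fun w => Real.log (1 + p w / (1 + q w))) ν := by
  have hint := (h.prod_halfStrip hσ hσκ).integrable_mul_exp_neg_mul_exp_neg hσ1 hκ
  refine hint.integral_prod_left.re.congr ?_
  filter_upwards [h.pos_left, h.pos_right] with w hp hq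
  rw [integral_superposition_eq_log hp hq]
  exact ofReal_re _

variable [SFinite ν]

lemma jointMoment_prod_halfStrip (hp : ∀ᵐ w ∂ν, 0 < p w) (hq : ∀ᵐ w ∂ν, 0 < q w) {s t : ℂ}
    (hs : 0 < s.re) (hst : 0 < (s + t).re) :
    jointMoment (ν.prod halfStrip) (fun z => p z.1 * z.2.1 * z.2.2) (fun z => q z.1 * z.2.2)
      (fun z => (Real.exp (-z.2.2) / (z.2.1 * z.2.2) : ℝ)) s t =
    jointMoment ν p q 1 s t * (1 / s * Gamma (s + t)) := by
  rw [jointMoment, jointMoment, ← integral_cpow_halfStrip hs hst, ← integral_prod_mul]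
  refine integral_congr_ae ?_
  filter_upwards [ae_prod_halfStrip_pos hp hq] with z ⟨hp, hq, hx, hy⟩
  rw [cpow_mul_cpow_mul_exp_div hp hq hx hy, Pi.one_apply, mul_one]

namespace HasJointMoment

lemma Gamma_mul_jointMoment_prod_halfStrip (h : HasJointMoment ν p q 1 σ κ) {s t : ℂ}
    (hs : 0 < s.re) (hst : 0 < (s + t).re) :
    Gamma (1 - s) * Gamma (-t) * jointMoment (ν.prod halfStrip) (fun z => p z.1 * z.2.1 * z.2.2)
      (fun z => q z.1 * z.2.2) (fun z => (Real.exp (-z.2.2) / (z.2.1 * z.2.2) : ℝ)) s t =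
    capacityKernel s t * jointMoment ν p q 1 s t := by
  rw [jointMoment_prod_halfStrip h.pos_left h.pos_right hs hst, capacityKernel]
  ring

lemma integrable_capacityKernel_mul_jointMoment (h : HasJointMoment ν p q 1 σ κ) (hσ : 0 < σ)
    (hσ1 : σ < 1) (hκ : κ < 0) (hσκ : 0 < σ + κ) :
    Integrable fun z : ℝ × ℝ => capacityKernel (σ + z.1 * I) (κ + z.2 * I) *
      jointMoment ν p q 1 (σ + z.1 * I) (κ + z.2 * I) := by
  refine ((h.prod_halfStrip hσ hσκ).integrable_Gamma_mul_jointMoment hσ1 hκ).congr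
    (.of_forall fun z => ?_)
  exact h.Gamma_mul_jointMoment_prod_halfStrip (by simpa using hσ) (by simpa using hσκ)

lemma integral_capacityKernel_mul_jointMoment (h : HasJointMoment ν p q 1 σ κ) (hσ : 0 < σ)
    (hσ1 : σ < 1) (hκ : κ < 0) (hσκ : 0 < σ + κ) :
    ∫ z : ℝ × ℝ, capacityKernel (σ + z.1 * I) (κ + z.2 * I) *
      jointMoment ν p q 1 (σ + z.1 * I) (κ + z.2 * I) =
    (2 * Real.pi) ^ 2 * (∫ w, Real.log (1 + p w / (1 + q w)) ∂ν : ℝ) := by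
  have hsup := h.prod_halfStrip hσ hσκ
  calc ∫ z : ℝ × ℝ, capacityKernel (σ + z.1 * I) (κ + z.2 * I) *
        jointMoment ν p q 1 (σ + z.1 * I) (κ + z.2 * I)
      = _ := integral_congr_ae (.of_forall fun z =>
          (h.Gamma_mul_jointMoment_prod_halfStrip (by simpa using hσ) (by simpa using hσκ)).symm)
    _ = _ := hsup.integral_Gamma_mul_jointMoment hσ1 hκ
    _ = _ := by
        rw [integral_prod _ (hsup.integrable_mul_exp_neg_mul_exp_neg hσ1 hκ),
          ← integral_complex_ofReal]
        congr 1
        refine integral_congr_ae ?_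
        filter_upwards [h.pos_left, h.pos_right] with w hp hq
        exact integral_superposition_eq_log hp hq

end HasJointMoment

end Superposition

/-! ### Generalized gamma distributions -/

/-- The density of the generalized gamma distribution on the positive half-line. It is not cut off
at `0`: its values at `x ≤ 0` are irrelevant for `genGammaMeasure`. -/
def genGammaPDF (a b c x : ℝ) : ℝ :=
  c * x ^ (a * c - 1) / (b ^ (a * c) * Real.Gamma a) * Real.exp (-((x / b) ^ c))

/-- The generalized gamma distribution, the fading law of which the exponential distribution
`a = c = 1` and the second component of the EGG mixture are instances. -/
def genGammaMeasure (a b c : ℝ) : Measure ℝ :=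
  (volume.restrict (Ioi 0)).withDensity fun x => ENNReal.ofReal (genGammaPDF a b c x)

instance (a b c : ℝ) : SFinite (genGammaMeasure a b c) :=
  inferInstanceAs (SFinite (Measure.withDensity _ _))

lemma measurable_genGammaPDF (a b c : ℝ) : Measurable (genGammaPDF a b c) := by
  unfold genGammaPDF
  fun_prop

lemma ae_genGammaMeasure_pos (a b c : ℝ) : ∀ᵐ x ∂genGammaMeasure a b c, 0 < x :=
  (withDensity_absolutelyContinuous _ _).ae_le (ae_restrict_mem measurableSet_Ioi)

lemma hasMellin_exp_neg_div_rpow {b c : ℝ} (hb : 0 < b) (hc : 0 < c) {z : ℂ} (hz : 0 < z.re) :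
    HasMellin (fun x : ℝ => (Real.exp (-((x / b) ^ c)) : ℂ)) z
      ((b : ℂ) ^ z * ((c : ℂ)⁻¹ * Gamma (z / c))) := by
  set f : ℝ → ℂ := fun x => Real.exp (-x) with hf
  have hzc : 0 < (z / c).re := by
    rw [div_ofReal_re]
    positivity
  have hconv : MellinConvergent f (z / c) := by
    refine (GammaIntegral_convergent hzc).congr_fun (fun x _ => ?_) measurableSet_Ioi
    rw [smul_eq_mul, mul_comm]
  have hcomp : (fun x : ℝ => (Real.exp (-((x / b) ^ c)) : ℂ)) = fun x => f ((b⁻¹ * x) ^ c) := by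
    simp only [hf, div_eq_inv_mul]
  rw [hcomp]
  refine ⟨(MellinConvergent.comp_mul_left (f := fun u => f (u ^ c)) (inv_pos.2 hb)).2
    ((MellinConvergent.comp_rpow hc.ne').2 hconv), ?_⟩
  rw [mellin_comp_mul_left (fun u => f (u ^ c)) _ (inv_pos.2 hb), mellin_comp_rpow,
    ← GammaIntegral_eq_mellin, ← Gamma_eq_integral hzc, abs_of_pos hc, ofReal_inv,
    inv_cpow_ofReal_nonneg hb.le, cpow_neg, inv_inv, smul_eq_mul, real_smul, ofReal_inv]

section Parameters

variable {a b c : ℝ}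

lemma genGammaPDF_nonneg (ha : 0 < a) (hb : 0 < b) (hc : 0 < c) {x : ℝ} (hx : 0 < x) :
    0 ≤ genGammaPDF a b c x := by
  have := Real.Gamma_pos_of_pos ha
  unfold genGammaPDF
  positivity

lemma genGammaPDF_smul_cpow (ha : 0 < a) (hb : 0 < b) (hc : 0 < c) (z : ℂ) {x : ℝ} (hx : 0 < x) :
    (ENNReal.ofReal (genGammaPDF a b c x)).toReal • (x : ℂ) ^ z =
      (c / (b ^ (a * c) * Real.Gamma a) : ℝ) *
        ((x : ℂ) ^ ((a * c + z) - 1) • (Real.exp (-((x / b) ^ c)) : ℂ)) := by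
  have hexp : (a * c + z : ℂ) - 1 = ((a * c - 1 : ℝ) : ℂ) + z := by
    push_cast
    ring
  rw [ENNReal.toReal_ofReal (genGammaPDF_nonneg ha hb hc hx), hexp,
    cpow_add _ _ (ofReal_ne_zero.2 hx.ne'), ← ofReal_cpow hx.le, genGammaPDF, real_smul,
    smul_eq_mul]
  push_cast
  ring

lemma integrable_cpow_genGammaMeasure (ha : 0 < a) (hb : 0 < b) (hc : 0 < c) {z : ℂ}
    (hz : 0 < a * c + z.re) : Integrable (fun x : ℝ => (x : ℂ) ^ z) (genGammaMeasure a b c) := by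
  rw [genGammaMeasure, integrable_withDensity_iff_integrable_smul'
    (measurable_genGammaPDF a b c).ennreal_ofReal (by simp)]
  have hconv := (hasMellin_exp_neg_div_rpow hb hc (z := a * c + z) (by simpa using hz)).1
  exact IntegrableOn.congr_fun (hconv.const_mul _)
    (fun x hx => (genGammaPDF_smul_cpow ha hb hc z hx).symm) measurableSet_Ioi

lemma integral_cpow_genGammaMeasure (ha : 0 < a) (hb : 0 < b) (hc : 0 < c) {z : ℂ}
    (hz : 0 < a * c + z.re) : ∫ x : ℝ, (x : ℂ) ^ z ∂genGammaMeasure a b c =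
      (b : ℂ) ^ z * (Gamma (a + z / c) / Real.Gamma a) := by
  have hb' : (b : ℂ) ≠ 0 := ofReal_ne_zero.2 hb.ne'
  have hc' : (c : ℂ) ≠ 0 := ofReal_ne_zero.2 hc.ne'
  have hba : (b : ℂ) ^ ((a : ℂ) * c) ≠ 0 := by simp [cpow_eq_zero_iff, hb']
  have hmellin := (hasMellin_exp_neg_div_rpow hb hc (z := a * c + z) (by simpa using hz)).2
  rw [mellin] at hmellin
  rw [genGammaMeasure, integral_withDensity_eq_integral_toReal_smul
    (measurable_genGammaPDF a b c).ennreal_ofReal (by simp),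
    setIntegral_congr_fun measurableSet_Ioi fun x hx => genGammaPDF_smul_cpow ha hb hc z hx,
    integral_const_mul, hmellin, cpow_add _ _ hb', add_div, mul_div_cancel_right₀ _ hc']
  push_cast [ofReal_cpow hb.le]
  generalize (b : ℂ) ^ ((a : ℂ) * c) = B at hba
  field_simp

lemma integrable_pow_genGammaMeasure (ha : 0 < a) (hb : 0 < b) (hc : 0 < c) (r : ℕ) :
    Integrable (fun x : ℝ => x ^ r) (genGammaMeasure a b c) := by
  refine (integrable_cpow_genGammaMeasure ha hb hc (z := r) ?_).re.congr (.of_forall fun x => ?_)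
  · rw [natCast_re]
    positivity
  · simp [← ofReal_pow]

lemma integral_pow_genGammaMeasure (ha : 0 < a) (hb : 0 < b) (hc : 0 < c) (r : ℕ) :
    ∫ x, x ^ r ∂genGammaMeasure a b c = b ^ r * (Real.Gamma (a + r / c) / Real.Gamma a) := by
  have hr : 0 < a * c + (r : ℂ).re := by
    rw [natCast_re]
    positivity
  have hmoment := integral_cpow_genGammaMeasure ha hb hc hr
  have harg : (a + r / c : ℂ) = (a + r / c : ℝ) := by push_cast; rfl
  simp only [cpow_natCast, ← ofReal_pow, integral_complex_ofReal, harg, Gamma_ofReal] at hmoment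
  exact_mod_cast hmoment

lemma ofReal_mul_pow_cpow {x w : ℝ} (hx : 0 ≤ x) (hw : 0 ≤ w) (r : ℕ) (z : ℂ) :
    ((x * w ^ r : ℝ) : ℂ) ^ z = (x : ℂ) ^ z * (w : ℂ) ^ (r * z) := by
  rw [ofReal_mul, mul_cpow_ofReal_nonneg hx (pow_nonneg hw r), ofReal_pow, ← cpow_nat_mul'] <;>
    simp [arg_ofReal_of_nonneg hw, Real.pi_pos, Real.pi_pos.le]

lemma ofReal_div_pow_cpow {y w : ℝ} (hy : 0 ≤ y) (hw : 0 ≤ w) (r : ℕ) (z : ℂ) :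
    ((y / w ^ r : ℝ) : ℂ) ^ z = ((y⁻¹ * w ^ r : ℝ) : ℂ) ^ (-z) := by
  rw [cpow_neg, ← inv_cpow_ofReal_nonneg (by positivity), ← ofReal_inv, mul_inv, inv_inv,
    div_eq_mul_inv]

lemma integrable_mul_pow_cpow_genGammaMeasure (ha : 0 < a) (hb : 0 < b) (hc : 0 < c) {x : ℝ}
    (hx : 0 ≤ x) (r : ℕ) {z : ℂ} (hz : 0 < a * c + r * z.re) :
    Integrable (fun w : ℝ => ((x * w ^ r : ℝ) : ℂ) ^ z) (genGammaMeasure a b c) := by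
  refine ((integrable_cpow_genGammaMeasure ha hb hc (z := r * z) (by simpa using hz)).const_mul
    ((x : ℂ) ^ z)).congr ?_
  filter_upwards [ae_genGammaMeasure_pos a b c] with w hw
  exact (ofReal_mul_pow_cpow hx hw.le r z).symm

lemma integral_mul_pow_cpow_genGammaMeasure (ha : 0 < a) (hb : 0 < b) (hc : 0 < c) {x : ℝ}
    (hx : 0 ≤ x) (r : ℕ) {z : ℂ} (hz : 0 < a * c + r * z.re) :
    ∫ w : ℝ, ((x * w ^ r : ℝ) : ℂ) ^ z ∂genGammaMeasure a b c =
      ((x * b ^ r : ℝ) : ℂ) ^ z * (Gamma (a + r * z / c) / Real.Gamma a) := by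
  rw [ofReal_mul_pow_cpow hx hb.le, mul_assoc,
    ← integral_cpow_genGammaMeasure ha hb hc (by simpa using hz), ← integral_const_mul]
  refine integral_congr_ae ?_
  filter_upwards [ae_genGammaMeasure_pos a b c] with w hw
  exact ofReal_mul_pow_cpow hx hw.le r z

end Parameters

/-! ### The Fox H functions of the capacity formula -/

section Bivariate

variable {n₁ p₁ q₁ m₂ n₂ p₂ q₂ m₃ n₃ p₃ q₃ : ℕ} {J : FoxHJointBlock n₁ p₁ q₁}
  {A : FoxHBlock m₂ n₂ p₂ q₂} {B : FoxHBlock m₃ n₃ p₃ q₃} {x y : ℝ} {h : ℂ}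

lemma IsBivariateFoxH.bivariateFoxH_eq (hh : IsBivariateFoxH J A B x y h) :
    bivariateFoxH J A B x y = h := by
  have hconv : BivariateFoxHConverges J A B x y := ⟨h, hh⟩
  obtain ⟨σ, κ, hJ, hA, hB⟩ := hh.1
  rw [bivariateFoxH, dif_pos hconv, ← (hh.2 σ κ hJ hA hB).2,
    (hconv.choose_spec.2 σ κ hJ hA hB).2]

lemma IsBivariateFoxH.congr_left {A' : FoxHBlock m₂ n₂ p₂ q₂}
    (hh : IsBivariateFoxH J A B x y h) (hkernel : ∀ s, A'.kernel s = A.kernel s)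
    (hsep : ∀ σ, A'.Separates σ ↔ A.Separates σ) : IsBivariateFoxH J A' B x y h := by
  have hintegrand : foxHIntegrand J A' B x y = foxHIntegrand J A B x y := by
    funext σ κ z
    simp only [foxHIntegrand, hkernel]
  simpa only [IsBivariateFoxH, hintegrand, hsep] using hh

end Bivariate

lemma capacitySecondExp_eq_capacitySecondGG (r : ℕ) :
    capacitySecondExp r = capacitySecondGG 1 1 r := by
  simp [capacitySecondExp, capacitySecondGG]

/- The two blocks differ in the order of their upper pairs, so they are not equal. -/
lemma capacityFirstExp_kernel (r : ℕ) (s : ℂ) :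
    (capacityFirstExp r).kernel s = (capacityFirstGG 1 1 r).kernel s := by
  simp [FoxHBlock.kernel, capacityFirstExp, capacityFirstGG, Fin.prod_univ_two, mul_comm]

lemma capacityFirstExp_separates (r : ℕ) (σ : ℝ) :
    (capacityFirstExp r).Separates σ ↔ (capacityFirstGG 1 1 r).Separates σ := by
  simp [FoxHBlock.Separates, capacityFirstExp, capacityFirstGG, Fin.forall_fin_two, and_comm]

lemma IsBivariateFoxH.capacityFirstExp {m n p q r : ℕ} {B : FoxHBlock m n p q} {x y : ℝ} {h : ℂ}
    (hh : IsBivariateFoxH capacityJoint (capacityFirstGG 1 1 r) B x y h) :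
    IsBivariateFoxH capacityJoint (capacityFirstExp r) B x y h :=
  hh.congr_left (capacityFirstExp_kernel r) (capacityFirstExp_separates r)

lemma capacityJoint_separates {σ κ : ℝ} : capacityJoint.Separates σ κ ↔ 0 < σ + κ := by
  simp [FoxHJointBlock.Separates, capacityJoint]

lemma capacityFirstGG_separates {a c σ : ℝ} (ha : 0 < a) (hc : 0 < c) (r : ℕ) :
    (capacityFirstGG a c r).Separates σ ↔ 0 < σ ∧ σ < 1 := by
  have hpos (hσ : 0 < σ) : 0 < a + r / c * σ := by positivity
  simpa [FoxHBlock.Separates, capacityFirstGG, Fin.forall_fin_two, and_comm] using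
    fun _ => hpos

lemma capacitySecondGG_separates {a c κ : ℝ} (ha : 0 < a) (hc : 0 < c) (r : ℕ) :
    (capacitySecondGG a c r).Separates κ ↔ κ < 0 := by
  have hpos (hκ : κ < 0) : r / c * κ < a :=
    (mul_nonpos_of_nonneg_of_nonpos (by positivity) hκ.le).trans_lt ha
  simpa [FoxHBlock.Separates, capacitySecondGG, Fin.forall_fin_two] using hpos

lemma capacityJoint_kernel (s t : ℂ) : capacityJoint.kernel s t = Gamma (s + t) := by
  simp [FoxHJointBlock.kernel, capacityJoint]

lemma capacityFirstGG_kernel (a c : ℝ) (r : ℕ) (s : ℂ) :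
    (capacityFirstGG a c r).kernel s =
      Gamma (1 - s) * (Gamma (1 + s))⁻¹ * (Gamma s * Gamma (a + r * s / c)) := by
  have harg : (r : ℂ) / c * s = r * s / c := by ring
  simp [FoxHBlock.kernel, capacityFirstGG, Fin.prod_univ_two, harg]

lemma capacitySecondGG_kernel (a c : ℝ) (r : ℕ) (t : ℂ) :
    (capacitySecondGG a c r).kernel t = Gamma (-t) * Gamma (a + r * -t / c) := by
  have harg : (a : ℂ) + r * -t / c = a - r / c * t := by ring
  rw [harg]
  simp [FoxHBlock.kernel, capacitySecondGG, Fin.prod_univ_two]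

lemma capacityGG_kernel (a₁ c₁ a₂ c₂ : ℝ) (r₁ r₂ : ℕ) {s : ℂ} (hs : 0 < s.re) (t : ℂ) :
    capacityJoint.kernel s t * (capacityFirstGG a₁ c₁ r₁).kernel s *
      (capacitySecondGG a₂ c₂ r₂).kernel t =
    capacityKernel s t * Gamma (a₁ + r₁ * s / c₁) * Gamma (a₂ + r₂ * -t / c₂) := by
  have hΓ : Gamma s / Gamma (1 + s) = 1 / s := by
    rw [add_comm, Gamma_add_one s (ne_zero_of_re_pos hs)]
    field_simp [Gamma_ne_zero_of_re_pos hs]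
  rw [capacityJoint_kernel, capacityFirstGG_kernel, capacitySecondGG_kernel, capacityKernel, ← hΓ]
  ring

/-! ### Capacity of links with generalized gamma fading -/

/-- The instantaneous capacity `log (1 + τ γ)` of the link at the fading state `w = (I₁, I₂)`, when
the SNRs of the hops are `μ₁ I₁ ^ r₁` and `μ₂ I₂ ^ r₂`. -/
def linkCapacity (C τ μ₁ μ₂ : ℝ) (r₁ r₂ : ℕ) (w : ℝ × ℝ) : ℝ :=
  Real.log (1 + τ * endToEndSNR C (μ₁ * w.1 ^ r₁) (μ₂ * w.2 ^ r₂))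

section GeneralizedGamma

variable {a₁ b₁ c₁ a₂ b₂ c₂ C τ μ₁ μ₂ : ℝ} {σ κ : ℝ}

lemma ae_genGammaMeasure_prod_pos :
    ∀ᵐ w ∂(genGammaMeasure a₁ b₁ c₁).prod (genGammaMeasure a₂ b₂ c₂), 0 < w.1 ∧ 0 < w.2 := by
  filter_upwards [Measure.quasiMeasurePreserving_fst.ae (ae_genGammaMeasure_pos a₁ b₁ c₁),
    Measure.quasiMeasurePreserving_snd.ae (ae_genGammaMeasure_pos a₂ b₂ c₂)] with w h₁ h₂
  exact ⟨h₁, h₂⟩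

lemma linkCapacity_eq_log (hC : 0 < C) (hμ₂ : 0 < μ₂) (r₁ r₂ : ℕ) {w : ℝ × ℝ} (hw : 0 < w.2) :
    linkCapacity C τ μ₁ μ₂ r₁ r₂ w =
      Real.log (1 + τ * μ₁ * w.1 ^ r₁ / (1 + C / μ₂ / w.2 ^ r₂)) := by
  have hden : μ₂ * w.2 ^ r₂ + C ≠ 0 := by positivity
  rw [linkCapacity, endToEndSNR]
  congr 2
  field_simp

lemma hasJointMoment_genGammaMeasure (ha₁ : 0 < a₁) (hb₁ : 0 < b₁) (hc₁ : 0 < c₁) (ha₂ : 0 < a₂)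
    (hb₂ : 0 < b₂) (hc₂ : 0 < c₂) {x y : ℝ} (hx : 0 < x) (hy : 0 < y) (r₁ r₂ : ℕ) (hσ : 0 ≤ σ)
    (hκ : κ ≤ 0) :
    HasJointMoment ((genGammaMeasure a₁ b₁ c₁).prod (genGammaMeasure a₂ b₂ c₂))
      (fun w => x * w.1 ^ r₁) (fun w => y / w.2 ^ r₂) 1 σ κ := by
  refine ⟨by fun_prop, by fun_prop, aestronglyMeasurable_const, ?_, ?_, ?_⟩
  · filter_upwards [ae_genGammaMeasure_prod_pos] with w hw using by have := hw.1; positivity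
  · filter_upwards [ae_genGammaMeasure_prod_pos] with w hw using by have := hw.2; positivity
  · have h₁ := integrable_mul_pow_cpow_genGammaMeasure ha₁ hb₁ hc₁ hx.le r₁ (z := σ)
      (by rw [ofReal_re]; positivity)
    have h₂ := integrable_mul_pow_cpow_genGammaMeasure ha₂ hb₂ hc₂ (inv_nonneg.2 hy.le) r₂
      (z := -κ) (by
        have := neg_nonneg.2 hκ
        rw [neg_re, ofReal_re]
        positivity)
    refine (h₁.mul_prod h₂).congr ?_
    filter_upwards [ae_genGammaMeasure_prod_pos] with w hw
    rw [ofReal_div_pow_cpow hy.le hw.2.le, Pi.one_apply, mul_one]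

lemma jointMoment_genGammaMeasure (ha₁ : 0 < a₁) (hb₁ : 0 < b₁) (hc₁ : 0 < c₁) (ha₂ : 0 < a₂)
    (hb₂ : 0 < b₂) (hc₂ : 0 < c₂) {x y : ℝ} (hx : 0 < x) (hy : 0 < y) (r₁ r₂ : ℕ) {s t : ℂ}
    (hs : 0 ≤ s.re) (ht : t.re ≤ 0) :
    jointMoment ((genGammaMeasure a₁ b₁ c₁).prod (genGammaMeasure a₂ b₂ c₂))
      (fun w => x * w.1 ^ r₁) (fun w => y / w.2 ^ r₂) 1 s t =
    ((x * b₁ ^ r₁ : ℝ) : ℂ) ^ s * (Gamma (a₁ + r₁ * s / c₁) / Real.Gamma a₁) *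
      (((y / b₂ ^ r₂ : ℝ) : ℂ) ^ t * (Gamma (a₂ + r₂ * -t / c₂) / Real.Gamma a₂)) := by
  have h₂ : 0 < a₂ * c₂ + r₂ * (-t).re := by
    have := neg_nonneg.2 ht
    rw [neg_re]
    positivity
  rw [ofReal_div_pow_cpow hy.le hb₂.le,
    ← integral_mul_pow_cpow_genGammaMeasure ha₁ hb₁ hc₁ hx.le r₁ (by positivity),
    ← integral_mul_pow_cpow_genGammaMeasure ha₂ hb₂ hc₂ (inv_nonneg.2 hy.le) r₂ h₂,
    ← integral_prod_mul, jointMoment]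
  refine integral_congr_ae ?_
  filter_upwards [ae_genGammaMeasure_prod_pos] with w hw
  rw [ofReal_div_pow_cpow hy.le hw.2.le, Pi.one_apply, mul_one]

lemma integrable_linkCapacity_genGammaMeasure (ha₁ : 0 < a₁) (hb₁ : 0 < b₁) (hc₁ : 0 < c₁)
    (ha₂ : 0 < a₂) (hb₂ : 0 < b₂) (hc₂ : 0 < c₂) (hC : 0 < C) (hτ : 0 < τ) (hμ₁ : 0 < μ₁)
    (hμ₂ : 0 < μ₂) (r₁ r₂ : ℕ) :
    Integrable (linkCapacity C τ μ₁ μ₂ r₁ r₂)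
      ((genGammaMeasure a₁ b₁ c₁).prod (genGammaMeasure a₂ b₂ c₂)) := by
  have hmoment := hasJointMoment_genGammaMeasure ha₁ hb₁ hc₁ ha₂ hb₂ hc₂ (mul_pos hτ hμ₁)
    (div_pos hC hμ₂) r₁ r₂ (σ := 1 / 2) (κ := -(1 / 4)) (by norm_num) (by norm_num)
  refine (hmoment.integrable_log (by norm_num) (by norm_num) (by norm_num) (by norm_num)).congr ?_
  filter_upwards [ae_genGammaMeasure_prod_pos] with w hw
  exact (linkCapacity_eq_log hC hμ₂ r₁ r₂ hw.2).symm

lemma foxHIntegrand_capacityGG (ha₁ : 0 < a₁) (hb₁ : 0 < b₁) (hc₁ : 0 < c₁) (ha₂ : 0 < a₂)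
    (hb₂ : 0 < b₂) (hc₂ : 0 < c₂) {x y : ℝ} (hx : 0 < x) (hy : 0 < y) (r₁ r₂ : ℕ) (hσ : 0 < σ)
    (hκ : κ ≤ 0) (z : ℝ × ℝ) :
    foxHIntegrand capacityJoint (capacityFirstGG a₁ c₁ r₁) (capacitySecondGG a₂ c₂ r₂)
      (x * b₁ ^ r₁) (y / b₂ ^ r₂) σ κ z =
    Real.Gamma a₁ * Real.Gamma a₂ * (capacityKernel (σ + z.1 * I) (κ + z.2 * I) *
      jointMoment ((genGammaMeasure a₁ b₁ c₁).prod (genGammaMeasure a₂ b₂ c₂))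
        (fun w => x * w.1 ^ r₁) (fun w => y / w.2 ^ r₂) 1 (σ + z.1 * I) (κ + z.2 * I)) := by
  have hΓ₁ : (Real.Gamma a₁ : ℂ) ≠ 0 := ofReal_ne_zero.2 (Real.Gamma_pos_of_pos ha₁).ne'
  have hΓ₂ : (Real.Gamma a₂ : ℂ) ≠ 0 := ofReal_ne_zero.2 (Real.Gamma_pos_of_pos ha₂).ne'
  rw [jointMoment_genGammaMeasure ha₁ hb₁ hc₁ ha₂ hb₂ hc₂ hx hy r₁ r₂ (by simpa using hσ.le)
    (by simpa using hκ), foxHIntegrand, capacityGG_kernel _ _ _ _ _ _ (by simpa using hσ)]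
  field_simp

lemma isBivariateFoxH_genGamma_genGamma (ha₁ : 0 < a₁) (hb₁ : 0 < b₁) (hc₁ : 0 < c₁)
    (ha₂ : 0 < a₂) (hb₂ : 0 < b₂) (hc₂ : 0 < c₂) (hC : 0 < C) (hτ : 0 < τ) (hμ₁ : 0 < μ₁)
    (hμ₂ : 0 < μ₂) (r₁ r₂ : ℕ) :
    IsBivariateFoxH capacityJoint (capacityFirstGG a₁ c₁ r₁) (capacitySecondGG a₂ c₂ r₂)
      (τ * b₁ ^ r₁ * μ₁) (C / (b₂ ^ r₂ * μ₂))
      (Real.Gamma a₁ * Real.Gamma a₂ * (∫ w, linkCapacity C τ μ₁ μ₂ r₁ r₂ w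
        ∂(genGammaMeasure a₁ b₁ c₁).prod (genGammaMeasure a₂ b₂ c₂) : ℝ)) := by
  have hx : 0 < τ * μ₁ := mul_pos hτ hμ₁
  have hy : 0 < C / μ₂ := div_pos hC hμ₂
  have hlog : ∫ w, linkCapacity C τ μ₁ μ₂ r₁ r₂ w
        ∂(genGammaMeasure a₁ b₁ c₁).prod (genGammaMeasure a₂ b₂ c₂) =
      ∫ w, Real.log (1 + τ * μ₁ * w.1 ^ r₁ / (1 + C / μ₂ / w.2 ^ r₂))
        ∂(genGammaMeasure a₁ b₁ c₁).prod (genGammaMeasure a₂ b₂ c₂) := by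
    refine integral_congr_ae ?_
    filter_upwards [ae_genGammaMeasure_prod_pos] with w hw
    exact linkCapacity_eq_log hC hμ₂ r₁ r₂ hw.2
  have hconst (c E : ℂ) :
      (1 / (2 * Real.pi * I)) ^ 2 * (I ^ 2 * (c * ((2 * Real.pi) ^ 2 * E))) = c * E := by
    field_simp [I_ne_zero, ofReal_ne_zero.2 Real.pi_ne_zero]
  rw [mul_right_comm τ, mul_comm (b₂ ^ r₂), ← div_div]
  simp only [IsBivariateFoxH, capacityJoint_separates, capacityFirstGG_separates ha₁ hc₁,
    capacitySecondGG_separates ha₂ hc₂]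
  refine ⟨⟨1 / 2, -(1 / 4), by norm_num⟩, fun σ κ hσκ ⟨hσ, hσ1⟩ hκ => ?_⟩
  have hmoment := hasJointMoment_genGammaMeasure ha₁ hb₁ hc₁ ha₂ hb₂ hc₂ hx hy r₁ r₂ hσ.le hκ.le
  simp only [funext (foxHIntegrand_capacityGG ha₁ hb₁ hc₁ ha₂ hb₂ hc₂ hx hy r₁ r₂ hσ hκ.le)]
  refine ⟨(hmoment.integrable_capacityKernel_mul_jointMoment hσ hσ1 hκ hσκ).const_mul _, ?_⟩
  rw [integral_const_mul, hmoment.integral_capacityKernel_mul_jointMoment hσ hσ1 hκ hσκ, hlog,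
    hconst]

end GeneralizedGamma

/-! ### Mixtures -/

/-- The mixture of `ν` and `ν'` with weights `ω` and `1 - ω`, for `ω` in the unit interval; the EGG
distribution and the joint law of two such distributions are of this form. -/
def mixture {α : Type*} [MeasurableSpace α] (ω : ℝ) (ν ν' : Measure α) : Measure α :=
  ENNReal.ofReal ω • ν + ENNReal.ofReal (1 - ω) • ν'

section Mixture

variable {α β : Type*} [MeasurableSpace α] [MeasurableSpace β] {ν ν' : Measure α} {ω : ℝ}

instance [SFinite ν] [SFinite ν'] : SFinite (mixture ω ν ν') :=
  inferInstanceAs (SFinite (_ + _))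

lemma integrable_mixture {f : α → ℝ} (h : Integrable f ν) (h' : Integrable f ν') :
    Integrable f (mixture ω ν ν') :=
  (h.smul_measure ENNReal.ofReal_ne_top).add_measure (h'.smul_measure ENNReal.ofReal_ne_top)

lemma integral_mixture {f : α → ℝ} (hω : ω ∈ Icc 0 1) (h : Integrable f ν) (h' : Integrable f ν') :
    ∫ x, f x ∂mixture ω ν ν' = ω * ∫ x, f x ∂ν + (1 - ω) * ∫ x, f x ∂ν' := by
  rw [mixture, integral_add_measure (h.smul_measure ENNReal.ofReal_ne_top)
    (h'.smul_measure ENNReal.ofReal_ne_top), integral_smul_measure, integral_smul_measure,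
    ENNReal.toReal_ofReal hω.1, ENNReal.toReal_ofReal (sub_nonneg.2 hω.2), smul_eq_mul, smul_eq_mul]

variable {ρ ρ' : Measure β} {θ : ℝ}

lemma mixture_prod [SFinite ν] [SFinite ν'] [SFinite ρ] :
    (mixture ω ν ν').prod ρ = mixture ω (ν.prod ρ) (ν'.prod ρ) := by
  simp only [mixture, Measure.add_prod, Measure.prod_smul_left]

lemma prod_mixture [SFinite ν] [SFinite ρ] [SFinite ρ'] :
    ν.prod (mixture θ ρ ρ') = mixture θ (ν.prod ρ) (ν.prod ρ') := by
  simp only [mixture, Measure.prod_add, Measure.prod_smul_right]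

variable [SFinite ν] [SFinite ν'] [SFinite ρ] [SFinite ρ'] {f : α × β → ℝ}

lemma integrable_mixture_prod_mixture (h : Integrable f (ν.prod ρ)) (h' : Integrable f (ν.prod ρ'))
    (k : Integrable f (ν'.prod ρ)) (k' : Integrable f (ν'.prod ρ')) :
    Integrable f ((mixture ω ν ν').prod (mixture θ ρ ρ')) := by
  rw [mixture_prod, prod_mixture, prod_mixture]
  exact integrable_mixture (integrable_mixture h h') (integrable_mixture k k')

lemma integral_mixture_prod_mixture (hω : ω ∈ Icc 0 1) (hθ : θ ∈ Icc 0 1)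
    (h : Integrable f (ν.prod ρ)) (h' : Integrable f (ν.prod ρ'))
    (k : Integrable f (ν'.prod ρ)) (k' : Integrable f (ν'.prod ρ')) :
    ∫ z, f z ∂(mixture ω ν ν').prod (mixture θ ρ ρ') =
      ω * (θ * ∫ z, f z ∂ν.prod ρ) + ω * ((1 - θ) * ∫ z, f z ∂ν.prod ρ') +
        (1 - ω) * (θ * ∫ z, f z ∂ν'.prod ρ) + (1 - ω) * ((1 - θ) * ∫ z, f z ∂ν'.prod ρ') := by
  rw [mixture_prod, prod_mixture, prod_mixture,
    integral_mixture hω (integrable_mixture h h') (integrable_mixture k k'),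
    integral_mixture hθ h h', integral_mixture hθ k k', mul_add, mul_add, ← add_assoc]

end Mixture

/-! ### The mixture Exponential-Generalized Gamma channel -/

section EGG

variable {ω lam a b c : ℝ}

lemma eggPDF_of_pos {x : ℝ} (hx : 0 < x) :
    eggPDF ω lam a b c x = ω * genGammaPDF 1 lam 1 x + (1 - ω) * genGammaPDF a b c x := by
  simp only [eggPDF, if_pos hx, genGammaPDF, mul_one, sub_self, Real.rpow_zero, Real.rpow_one,
    Real.Gamma_one]
  ring

lemma eggMeasure_eq_mixture (hω : ω ∈ Icc 0 1) (hlam : 0 < lam) (ha : 0 < a) (hb : 0 < b)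
    (hc : 0 < c) :
    eggMeasure ω lam a b c = mixture ω (genGammaMeasure 1 lam 1) (genGammaMeasure a b c) := by
  have hmeas (a b c : ℝ) : Measurable fun x => ENNReal.ofReal (genGammaPDF a b c x) :=
    (measurable_genGammaPDF a b c).ennreal_ofReal
  rw [mixture, genGammaMeasure, genGammaMeasure, ← withDensity_smul _ (hmeas _ _ _),
    ← withDensity_smul _ (hmeas _ _ _), ← withDensity_add_left ((hmeas _ _ _).const_smul _),
    ← withDensity_indicator measurableSet_Ioi, eggMeasure]
  congr 1
  funext x
  by_cases hx : 0 < x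
  · have hexp := mul_nonneg hω.1 (genGammaPDF_nonneg one_pos hlam one_pos hx)
    have hgg := mul_nonneg (sub_nonneg.2 hω.2) (genGammaPDF_nonneg ha hb hc hx)
    rw [indicator_of_mem (mem_Ioi.2 hx), eggPDF_of_pos hx, ENNReal.ofReal_add hexp hgg,
      ENNReal.ofReal_mul hω.1, ENNReal.ofReal_mul (sub_nonneg.2 hω.2)]
    rfl
  · rw [indicator_of_notMem (notMem_Ioi.2 (not_lt.1 hx)), eggPDF, if_neg hx, ENNReal.ofReal_zero]

lemma integral_pow_eggMeasure (hω : ω ∈ Icc 0 1) (hlam : 0 < lam) (ha : 0 < a) (hb : 0 < b)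
    (hc : 0 < c) (r : ℕ) :
    ∫ x, x ^ r ∂eggMeasure ω lam a b c = ω * lam ^ r * Real.Gamma (1 + r) +
      (1 - ω) * b ^ r * (Real.Gamma (a + r / c) / Real.Gamma a) := by
  rw [eggMeasure_eq_mixture hω hlam ha hb hc,
    integral_mixture hω (integrable_pow_genGammaMeasure one_pos hlam one_pos r)
      (integrable_pow_genGammaMeasure ha hb hc r),
    integral_pow_genGammaMeasure one_pos hlam one_pos, integral_pow_genGammaMeasure ha hb hc,
    Real.Gamma_one, div_one, div_one, mul_assoc, mul_assoc]

lemma integral_pow_eggMeasure_pos (hω : ω ∈ Icc 0 1) (hlam : 0 < lam) (ha : 0 < a) (hb : 0 < b)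
    (hc : 0 < c) (r : ℕ) : 0 < ∫ x, x ^ r ∂eggMeasure ω lam a b c := by
  have hexp : 0 < lam ^ r * Real.Gamma (1 + r) :=
    mul_pos (pow_pos hlam r) (Real.Gamma_pos_of_pos (by positivity))
  have hgg : 0 < b ^ r * (Real.Gamma (a + r / c) / Real.Gamma a) :=
    mul_pos (pow_pos hb r)
      (div_pos (Real.Gamma_pos_of_pos (by positivity)) (Real.Gamma_pos_of_pos ha))
  rw [integral_pow_eggMeasure hω hlam ha hb hc, mul_assoc, mul_assoc]
  exact convex_Ioi (0 : ℝ) hexp hgg hω.1 (sub_nonneg.2 hω.2) (add_sub_cancel _ _)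

lemma hopSNR_eq (η N₀ : ℝ) (r : ℕ) (x : ℝ) : hopSNR η N₀ r x = η ^ r / N₀ * x ^ r := by
  rw [hopSNR, mul_pow, mul_div_right_comm]

lemma averageElectricalSNR_integral_hopSNR {Ω : Type*} [MeasurableSpace Ω] {P : Measure Ω}
    {X : Ω → ℝ} {η N₀ : ℝ} {r : ℕ} (hω : ω ∈ Icc 0 1) (hlam : 0 < lam) (ha : 0 < a) (hb : 0 < b)
    (hc : 0 < c) (hX : HasLaw X (eggMeasure ω lam a b c) P) :
    averageElectricalSNR ω lam a b c r (∫ x, hopSNR η N₀ r (X x) ∂P) = η ^ r / N₀ := by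
  have hmean : ∫ x, hopSNR η N₀ r (X x) ∂P = η ^ r / N₀ * ∫ x, x ^ r ∂eggMeasure ω lam a b c := by
    rw [← hX.integral_comp (f := fun x => x ^ r) (by fun_prop), ← integral_const_mul]
    simp only [hopSNR_eq, Function.comp_apply]
  rw [averageElectricalSNR, hmean, ← integral_pow_eggMeasure hω hlam ha hb hc r,
    mul_div_cancel_right₀ _ (integral_pow_eggMeasure_pos hω hlam ha hb hc r).ne']

end EGG

/-! ### Capacity of links with EGG fading -/

section Link

variable {ω₁ lam₁ a₁ b₁ c₁ ω₂ lam₂ a₂ b₂ c₂ C τ μ₁ μ₂ : ℝ}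

lemma isBivariateFoxH_exp_genGamma (hlam₁ : 0 < lam₁) (ha₂ : 0 < a₂) (hb₂ : 0 < b₂) (hc₂ : 0 < c₂)
    (hC : 0 < C) (hτ : 0 < τ) (hμ₁ : 0 < μ₁) (hμ₂ : 0 < μ₂) (r₁ r₂ : ℕ) :
    IsBivariateFoxH capacityJoint (capacityFirstExp r₁) (capacitySecondGG a₂ c₂ r₂)
      (τ * lam₁ ^ r₁ * μ₁) (C / (b₂ ^ r₂ * μ₂))
      (Real.Gamma a₂ * (∫ w, linkCapacity C τ μ₁ μ₂ r₁ r₂ w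
        ∂(genGammaMeasure 1 lam₁ 1).prod (genGammaMeasure a₂ b₂ c₂) : ℝ)) := by
  simpa only [Real.Gamma_one, ofReal_one, one_mul] using
    (isBivariateFoxH_genGamma_genGamma one_pos hlam₁ one_pos ha₂ hb₂ hc₂ hC hτ hμ₁ hμ₂ r₁
      r₂).capacityFirstExp

lemma isBivariateFoxH_genGamma_exp (ha₁ : 0 < a₁) (hb₁ : 0 < b₁) (hc₁ : 0 < c₁) (hlam₂ : 0 < lam₂)
    (hC : 0 < C) (hτ : 0 < τ) (hμ₁ : 0 < μ₁) (hμ₂ : 0 < μ₂) (r₁ r₂ : ℕ) :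
    IsBivariateFoxH capacityJoint (capacityFirstGG a₁ c₁ r₁) (capacitySecondExp r₂)
      (τ * b₁ ^ r₁ * μ₁) (C / (lam₂ ^ r₂ * μ₂))
      (Real.Gamma a₁ * (∫ w, linkCapacity C τ μ₁ μ₂ r₁ r₂ w
        ∂(genGammaMeasure a₁ b₁ c₁).prod (genGammaMeasure 1 lam₂ 1) : ℝ)) := by
  simpa only [Real.Gamma_one, ofReal_one, mul_one, ← capacitySecondExp_eq_capacitySecondGG] using
    isBivariateFoxH_genGamma_genGamma ha₁ hb₁ hc₁ one_pos hlam₂ one_pos hC hτ hμ₁ hμ₂ r₁ r₂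

lemma isBivariateFoxH_exp_exp (hlam₁ : 0 < lam₁) (hlam₂ : 0 < lam₂) (hC : 0 < C) (hτ : 0 < τ)
    (hμ₁ : 0 < μ₁) (hμ₂ : 0 < μ₂) (r₁ r₂ : ℕ) :
    IsBivariateFoxH capacityJoint (capacityFirstExp r₁) (capacitySecondExp r₂)
      (τ * lam₁ ^ r₁ * μ₁) (C / (lam₂ ^ r₂ * μ₂))
      (∫ w, linkCapacity C τ μ₁ μ₂ r₁ r₂ w
        ∂(genGammaMeasure 1 lam₁ 1).prod (genGammaMeasure 1 lam₂ 1) : ℝ) := by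
  simpa only [Real.Gamma_one, ofReal_one, one_mul] using
    (isBivariateFoxH_genGamma_exp one_pos hlam₁ one_pos hlam₂ hC hτ hμ₁ hμ₂ r₁ r₂).capacityFirstExp

lemma integrable_linkCapacity_eggMeasure (hω₁ : ω₁ ∈ Icc 0 1) (hlam₁ : 0 < lam₁) (ha₁ : 0 < a₁)
    (hb₁ : 0 < b₁) (hc₁ : 0 < c₁) (hω₂ : ω₂ ∈ Icc 0 1) (hlam₂ : 0 < lam₂) (ha₂ : 0 < a₂)
    (hb₂ : 0 < b₂) (hc₂ : 0 < c₂) (hC : 0 < C) (hτ : 0 < τ) (hμ₁ : 0 < μ₁) (hμ₂ : 0 < μ₂)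
    (r₁ r₂ : ℕ) :
    Integrable (linkCapacity C τ μ₁ μ₂ r₁ r₂)
      ((eggMeasure ω₁ lam₁ a₁ b₁ c₁).prod (eggMeasure ω₂ lam₂ a₂ b₂ c₂)) := by
  rw [eggMeasure_eq_mixture hω₁ hlam₁ ha₁ hb₁ hc₁, eggMeasure_eq_mixture hω₂ hlam₂ ha₂ hb₂ hc₂]
  apply integrable_mixture_prod_mixture <;>
    apply integrable_linkCapacity_genGammaMeasure <;> first | assumption | exact one_pos

lemma integral_linkCapacity_eggMeasure (hω₁ : ω₁ ∈ Icc 0 1) (hlam₁ : 0 < lam₁) (ha₁ : 0 < a₁)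
    (hb₁ : 0 < b₁) (hc₁ : 0 < c₁) (hω₂ : ω₂ ∈ Icc 0 1) (hlam₂ : 0 < lam₂) (ha₂ : 0 < a₂)
    (hb₂ : 0 < b₂) (hc₂ : 0 < c₂) (hC : 0 < C) (hτ : 0 < τ) (hμ₁ : 0 < μ₁) (hμ₂ : 0 < μ₂)
    (r₁ r₂ : ℕ) :
    ((∫ w, linkCapacity C τ μ₁ μ₂ r₁ r₂ w
      ∂(eggMeasure ω₁ lam₁ a₁ b₁ c₁).prod (eggMeasure ω₂ lam₂ a₂ b₂ c₂) : ℝ) : ℂ) =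
      ω₁ * ω₂ *
        bivariateFoxH capacityJoint (capacityFirstExp r₁) (capacitySecondExp r₂)
          (τ * lam₁ ^ r₁ * μ₁) (C / (lam₂ ^ r₂ * μ₂))
      + ω₁ * (1 - ω₂) / Real.Gamma a₂ *
        bivariateFoxH capacityJoint (capacityFirstExp r₁) (capacitySecondGG a₂ c₂ r₂)
          (τ * lam₁ ^ r₁ * μ₁) (C / (b₂ ^ r₂ * μ₂))
      + ω₂ * (1 - ω₁) / Real.Gamma a₁ *
        bivariateFoxH capacityJoint (capacityFirstGG a₁ c₁ r₁) (capacitySecondExp r₂)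
          (τ * b₁ ^ r₁ * μ₁) (C / (lam₂ ^ r₂ * μ₂))
      + (1 - ω₁) * (1 - ω₂) / (Real.Gamma a₁ * Real.Gamma a₂) *
        bivariateFoxH capacityJoint (capacityFirstGG a₁ c₁ r₁) (capacitySecondGG a₂ c₂ r₂)
          (τ * b₁ ^ r₁ * μ₁) (C / (b₂ ^ r₂ * μ₂)) := by
  have hΓ₁ : (Real.Gamma a₁ : ℂ) ≠ 0 := ofReal_ne_zero.2 (Real.Gamma_pos_of_pos ha₁).ne'
  have hΓ₂ : (Real.Gamma a₂ : ℂ) ≠ 0 := ofReal_ne_zero.2 (Real.Gamma_pos_of_pos ha₂).ne'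
  rw [(isBivariateFoxH_exp_exp hlam₁ hlam₂ hC hτ hμ₁ hμ₂ r₁ r₂).bivariateFoxH_eq,
    (isBivariateFoxH_exp_genGamma hlam₁ ha₂ hb₂ hc₂ hC hτ hμ₁ hμ₂ r₁ r₂).bivariateFoxH_eq,
    (isBivariateFoxH_genGamma_exp ha₁ hb₁ hc₁ hlam₂ hC hτ hμ₁ hμ₂ r₁ r₂).bivariateFoxH_eq,
    (isBivariateFoxH_genGamma_genGamma ha₁ hb₁ hc₁ ha₂ hb₂ hc₂ hC hτ hμ₁ hμ₂ r₁
      r₂).bivariateFoxH_eq,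
    eggMeasure_eq_mixture hω₁ hlam₁ ha₁ hb₁ hc₁, eggMeasure_eq_mixture hω₂ hlam₂ ha₂ hb₂ hc₂,
    integral_mixture_prod_mixture hω₁ hω₂]
  · push_cast
    field_simp
  all_goals
    apply integrable_linkCapacity_genGammaMeasure <;> first | assumption | exact one_pos

end Link

end

theorem theorem5_general
    {Ω : Type*} [MeasurableSpace Ω] (P : Measure Ω) [IsProbabilityMeasure P]
    (ω₁ lam₁ a₁ b₁ c₁ ω₂ lam₂ a₂ b₂ c₂ : ℝ)
    (hω₁ : ω₁ ∈ Set.Icc 0 1) (hω₂ : ω₂ ∈ Set.Icc 0 1)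
    (hlam₁ : 0 < lam₁) (ha₁ : 0 < a₁) (hb₁ : 0 < b₁) (hc₁ : 0 < c₁)
    (hlam₂ : 0 < lam₂) (ha₂ : 0 < a₂) (hb₂ : 0 < b₂) (hc₂ : 0 < c₂)
    (r₁ r₂ : ℕ)
    (η N₁ N₂ C τ : ℝ) (hη : 0 < η) (hN₁ : 0 < N₁) (hN₂ : 0 < N₂) (hC : 0 < C) (hτ : 0 < τ)
    (I₁ I₂ : Ω → ℝ)
    (hI₁ : HasLaw I₁ (eggMeasure ω₁ lam₁ a₁ b₁ c₁) P)
    (hI₂ : HasLaw I₂ (eggMeasure ω₂ lam₂ a₂ b₂ c₂) P)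
    (hind : IndepFun I₁ I₂ P)
    (γ₁ γ₂ γ : Ω → ℝ)
    (hγ₁ : ∀ x, γ₁ x = hopSNR η N₁ r₁ (I₁ x)) (hγ₂ : ∀ x, γ₂ x = hopSNR η N₂ r₂ (I₂ x))
    (hγ : ∀ x, γ x = endToEndSNR C (γ₁ x) (γ₂ x))
    (μ₁ μ₂ : ℝ)
    (hμ₁ : μ₁ = averageElectricalSNR ω₁ lam₁ a₁ b₁ c₁ r₁ (∫ x, γ₁ x ∂P))
    (hμ₂ : μ₂ = averageElectricalSNR ω₂ lam₂ a₂ b₂ c₂ r₂ (∫ x, γ₂ x ∂P)) :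
    Integrable (fun x => Real.log (1 + τ * γ x)) P ∧
    BivariateFoxHConverges capacityJoint (capacityFirstExp r₁) (capacitySecondExp r₂)
      (τ * lam₁ ^ r₁ * μ₁) (C / (lam₂ ^ r₂ * μ₂)) ∧
    BivariateFoxHConverges capacityJoint (capacityFirstExp r₁) (capacitySecondGG a₂ c₂ r₂)
      (τ * lam₁ ^ r₁ * μ₁) (C / (b₂ ^ r₂ * μ₂)) ∧
    BivariateFoxHConverges capacityJoint (capacityFirstGG a₁ c₁ r₁) (capacitySecondExp r₂)
      (τ * b₁ ^ r₁ * μ₁) (C / (lam₂ ^ r₂ * μ₂)) ∧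
    BivariateFoxHConverges capacityJoint (capacityFirstGG a₁ c₁ r₁) (capacitySecondGG a₂ c₂ r₂)
      (τ * b₁ ^ r₁ * μ₁) (C / (b₂ ^ r₂ * μ₂)) ∧
    ((∫ x, Real.log (1 + τ * γ x) ∂P : ℝ) : ℂ) =
      ω₁ * ω₂ *
        bivariateFoxH capacityJoint (capacityFirstExp r₁) (capacitySecondExp r₂)
          (τ * lam₁ ^ r₁ * μ₁) (C / (lam₂ ^ r₂ * μ₂))
      + ω₁ * (1 - ω₂) / Real.Gamma a₂ *
        bivariateFoxH capacityJoint (capacityFirstExp r₁) (capacitySecondGG a₂ c₂ r₂)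
          (τ * lam₁ ^ r₁ * μ₁) (C / (b₂ ^ r₂ * μ₂))
      + ω₂ * (1 - ω₁) / Real.Gamma a₁ *
        bivariateFoxH capacityJoint (capacityFirstGG a₁ c₁ r₁) (capacitySecondExp r₂)
          (τ * b₁ ^ r₁ * μ₁) (C / (lam₂ ^ r₂ * μ₂))
      + (1 - ω₁) * (1 - ω₂) / (Real.Gamma a₁ * Real.Gamma a₂) *
        bivariateFoxH capacityJoint (capacityFirstGG a₁ c₁ r₁) (capacitySecondGG a₂ c₂ r₂)
          (τ * b₁ ^ r₁ * μ₁) (C / (b₂ ^ r₂ * μ₂)) := by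
  simp only [hγ₁] at hμ₁
  simp only [hγ₂] at hμ₂
  rw [averageElectricalSNR_integral_hopSNR hω₁ hlam₁ ha₁ hb₁ hc₁ hI₁] at hμ₁
  rw [averageElectricalSNR_integral_hopSNR hω₂ hlam₂ ha₂ hb₂ hc₂ hI₂] at hμ₂
  have hμ₁_pos : 0 < μ₁ := hμ₁ ▸ by positivity
  have hμ₂_pos : 0 < μ₂ := hμ₂ ▸ by positivity
  have hcap : (fun x => Real.log (1 + τ * γ x)) =
      linkCapacity C τ μ₁ μ₂ r₁ r₂ ∘ fun x => (I₁ x, I₂ x) := by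
    funext x
    rw [hγ, hγ₁, hγ₂, hopSNR_eq, hopSNR_eq, ← hμ₁, ← hμ₂, Function.comp_apply, linkCapacity]
  have hlaw := hind.hasLaw_prod hI₁ hI₂
  have hint := integrable_linkCapacity_eggMeasure hω₁ hlam₁ ha₁ hb₁ hc₁ hω₂ hlam₂ ha₂ hb₂ hc₂
    hC hτ hμ₁_pos hμ₂_pos r₁ r₂
  rw [hcap, hlaw.integral_comp hint.1]
  exact ⟨(hlaw.map_eq ▸ hint).comp_aemeasurable hlaw.aemeasurable,
    ⟨_, isBivariateFoxH_exp_exp hlam₁ hlam₂ hC hτ hμ₁_pos hμ₂_pos r₁ r₂⟩,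
    ⟨_, isBivariateFoxH_exp_genGamma hlam₁ ha₂ hb₂ hc₂ hC hτ hμ₁_pos hμ₂_pos r₁ r₂⟩,
    ⟨_, isBivariateFoxH_genGamma_exp ha₁ hb₁ hc₁ hlam₂ hC hτ hμ₁_pos hμ₂_pos r₁ r₂⟩,
    ⟨_, isBivariateFoxH_genGamma_genGamma ha₁ hb₁ hc₁ ha₂ hb₂ hc₂ hC hτ hμ₁_pos hμ₂_pos r₁ r₂⟩,
    integral_linkCapacity_eggMeasure hω₁ hlam₁ ha₁ hb₁ hc₁ hω₂ hlam₂ ha₂ hb₂ hc₂ hC hτ hμ₁_pos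
      hμ₂_pos r₁ r₂⟩

theorem theorem5
    {Ω : Type*} [MeasurableSpace Ω] (P : Measure Ω) [IsProbabilityMeasure P]
    -- parameters of the two EGG fading distributions
    (ω₁ lam₁ a₁ b₁ c₁ ω₂ lam₂ a₂ b₂ c₂ : ℝ)
    (hω₁ : 0 < ω₁ ∧ ω₁ < 1) (hω₂ : 0 < ω₂ ∧ ω₂ < 1)
    (hlam₁ : 0 < lam₁) (ha₁ : 0 < a₁) (hb₁ : 0 < b₁) (hc₁ : 0 < c₁)
    (hlam₂ : 0 < lam₂) (ha₂ : 0 < a₂) (hb₂ : 0 < b₂) (hc₂ : 0 < c₂)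
    -- the detection types (1 for heterodyne, 2 for IM/DD)
    (r₁ r₂ : ℕ) (hr₁ : r₁ = 1 ∨ r₁ = 2) (hr₂ : r₂ = 1 ∨ r₂ = 2)
    -- conversion ratio, noise powers, relay constant, capacity constant
    (η N₁ N₂ C τ : ℝ) (hη : 0 < η) (hN₁ : 0 < N₁) (hN₂ : 0 < N₂) (hC : 0 < C) (hτ : 0 < τ)
    -- independent EGG irradiances
    (I₁ I₂ : Ω → ℝ)
    (hI₁ : HasLaw I₁ (eggMeasure ω₁ lam₁ a₁ b₁ c₁) P)
    (hI₂ : HasLaw I₂ (eggMeasure ω₂ lam₂ a₂ b₂ c₂) P)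
    (hind : IndepFun I₁ I₂ P)
    -- the SNRs of the hops, their average electrical SNRs, and the end-to-end SNR
    (γ₁ γ₂ γ : Ω → ℝ)
    (hγ₁ : ∀ x, γ₁ x = hopSNR η N₁ r₁ (I₁ x)) (hγ₂ : ∀ x, γ₂ x = hopSNR η N₂ r₂ (I₂ x))
    (hγ : ∀ x, γ x = endToEndSNR C (γ₁ x) (γ₂ x))
    (μ₁ μ₂ : ℝ)
    (hμ₁ : μ₁ = averageElectricalSNR ω₁ lam₁ a₁ b₁ c₁ r₁ (∫ x, γ₁ x ∂P))
    (hμ₂ : μ₂ = averageElectricalSNR ω₂ lam₂ a₂ b₂ c₂ r₂ (∫ x, γ₂ x ∂P)) :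
    -- all the objects exist
    Integrable (fun x => Real.log (1 + τ * γ x)) P ∧
    BivariateFoxHConverges capacityJoint (capacityFirstExp r₁) (capacitySecondExp r₂)
      (τ * lam₁ ^ r₁ * μ₁) (C / (lam₂ ^ r₂ * μ₂)) ∧
    BivariateFoxHConverges capacityJoint (capacityFirstExp r₁) (capacitySecondGG a₂ c₂ r₂)
      (τ * lam₁ ^ r₁ * μ₁) (C / (b₂ ^ r₂ * μ₂)) ∧
    BivariateFoxHConverges capacityJoint (capacityFirstGG a₁ c₁ r₁) (capacitySecondExp r₂)
      (τ * b₁ ^ r₁ * μ₁) (C / (lam₂ ^ r₂ * μ₂)) ∧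
    BivariateFoxHConverges capacityJoint (capacityFirstGG a₁ c₁ r₁) (capacitySecondGG a₂ c₂ r₂)
      (τ * b₁ ^ r₁ * μ₁) (C / (b₂ ^ r₂ * μ₂)) ∧
    -- the ergodic capacity
    ((∫ x, Real.log (1 + τ * γ x) ∂P : ℝ) : ℂ) =
      ω₁ * ω₂ *
        bivariateFoxH capacityJoint (capacityFirstExp r₁) (capacitySecondExp r₂)
          (τ * lam₁ ^ r₁ * μ₁) (C / (lam₂ ^ r₂ * μ₂))
      + ω₁ * (1 - ω₂) / Real.Gamma a₂ *
        bivariateFoxH capacityJoint (capacityFirstExp r₁) (capacitySecondGG a₂ c₂ r₂)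
          (τ * lam₁ ^ r₁ * μ₁) (C / (b₂ ^ r₂ * μ₂))
      + ω₂ * (1 - ω₁) / Real.Gamma a₁ *
        bivariateFoxH capacityJoint (capacityFirstGG a₁ c₁ r₁) (capacitySecondExp r₂)
          (τ * b₁ ^ r₁ * μ₁) (C / (lam₂ ^ r₂ * μ₂))
      + (1 - ω₁) * (1 - ω₂) / (Real.Gamma a₁ * Real.Gamma a₂) *
        bivariateFoxH capacityJoint (capacityFirstGG a₁ c₁ r₁) (capacitySecondGG a₂ c₂ r₂)
          (τ * b₁ ^ r₁ * μ₁) (C / (b₂ ^ r₂ * μ₂)) :=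
  theorem5_general P ω₁ lam₁ a₁ b₁ c₁ ω₂ lam₂ a₂ b₂ c₂ ⟨hω₁.1.le, hω₁.2.le⟩ ⟨hω₂.1.le, hω₂.2.le⟩
    hlam₁ ha₁ hb₁ hc₁ hlam₂ ha₂ hb₂ hc₂ r₁ r₂ η N₁ N₂ C τ hη hN₁ hN₂ hC hτ I₁ I₂ hI₁ hI₂ hind
    γ₁ γ₂ γ hγ₁ hγ₂ hγ μ₁ μ₂ hμ₁ hμ₂
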